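/- Let $k$ be a field. A *semigroup category* is a category with a tensor product bifunctor (written as juxtaposition) and an associativity isomorphism $a$ satisfying the pentagon axiom (a monoidal category without a unit object). Let $\mathcal S$ be a small $k$-linear semigroup category, that is, $\mathcal S$ is a small category enriched in $k$-vector spaces and its tensor product is $k$-bilinear on morphisms. *Duals.* Let $F,G\in\mathcal S$. An *adjunction* $(F,G,\eta^{l},\eta^{r},\varepsilon^{l},\varepsilon^{r})$ consists of natural transformations $$\eta^{l}_X: X\to X(GF),\quad \varepsilon^{l}_X: X(FG)\to X,\quad \eta^{r}_X: X\to (GF)X,\quad \varepsilon^{r}_X: (FG)X\to X,$$ where $\eta^{l},\varepsilon^{l}$ are transformations of left $\mathcal S$-module functors (i.e. $\eta^l_{XY}=X\eta^l_Y$, $\varepsilon^l_{XY}=X\varepsilon^l_Y$) and $\eta^{r},\varepsilon^{r}$ are transformations of right $\mathcal S$-module functors (i.e. $\eta^r_{XY}=\eta^r_XY$, $\varepsilon^r_{XY}=\varepsilon^r_XY$), such that, suppressing associators, * $\eta^l,\varepsilon^l$ are unit and counit of an adjunction $(-\otimes G)\dashv(-\otimes F)$: $\ \varepsilon^l_{XG}\circ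 \eta^l_XG=\mathrm{id}_{XG}$ and $\varepsilon^l_XF\circ\eta^l_{XF}=\mathrm{id}_{XF}$ for all $X$; * $\eta^r,\varepsilon^r$ are unit and counit of an adjunction $(F\otimes-)\dashv(G\otimes-)$: $\ \varepsilon^r_{FX}\circ F\eta^r_X=\mathrm{id}_{FX}$ and $G\varepsilon^r_X\circ\eta^r_{GX}=\mathrm{id}_{GX}$ for all $X$; * $\varepsilon^r_F\circ\eta^l_F=\mathrm{id}_F$ and $\varepsilon^l_G\circ\eta^r_G=\mathrm{id}_G$; * $H\eta^r_K=\eta^l_HK$ and $H\varepsilon^r_K=\varepsilon^l_HK$ for all $H,K$. Then $G$ is called a *right dual* of $F$, and $F$ a *left dual* of $G$. The semigroup category $\mathcal S$ is *rigid* if every object has a right dual and a left dual. For an object $F$, let $F^{\diamond}$ be a right dual, with adjunction $(F,F^{\diamond},\eta^{F,l},\eta^{F,r},\varepsilon^{F,l},\varepsilon^{F,r})$. *Liberal functors.* A functor $T:\mathcal A\to\mathcal B$ between $k$-linear categories is *liberal* if every object $Y$ of $\mathcal B$ is a direct summand of a finite direct sum of objects $T(X_1),\dots,T(X_n)$; that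 is, there are $n\ge 0$, objects $X_1,\dots,X_n$ of $\mathcal A$ and morphisms $i_j: Y\to T(X_j)$, $p_j: T(X_j)\to Y$ with $\sum_j p_j\circ i_j=\mathrm{id}_Y$. (Existence of the direct sum in $\mathcal B$ is not required.) *Presheaves.* Let $[\mathcal S^{\mathrm{op}},\mathbf{Vec}_k]$ be the category of $k$-linear presheaves on $\mathcal S$, a semigroup category under Day convolution $$(P\circledast Q)(X)=\int^{H,K\in\mathcal S}\mathrm{Hom}_{\mathcal S}(X,HK)\otimes_k P(H)\otimes_k Q(K)$$ with associativity isomorphism induced by that of $\mathcal S$. Let $\mathbb 1$ be the presheaf which sends $X$ to the space $\mathrm{Hom}_{\mathrm{Mod}\text{-}\mathcal S(\mathcal S,\mathcal S)}(X\otimes-,\mathrm{Id}_{\mathcal S})$ of transformations of right $\mathcal S$-module functors, i.e. of natural families $\alpha_H: XH\to H$ with $\alpha_{HK}=\alpha_HK$ (associators suppressed), acting on morphisms by precomposition. **Theorem.** Let $\mathcal S$ be a small rigid $k$-linear semigroup category, $F$ an object of $\mathcal S$ such that $F\otimes-:\mathcal S\to\mathcal S$ is liberal, and $F^{\diamond}$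 a right dual of $F$. Then $\mathbb 1$ is a monoidal unit of $[\mathcal S^{\mathrm{op}},\mathbf{Vec}_k]$ with Day convolution: there are natural isomorphisms $\mathbb 1\circledast P\cong P$ and $P\circledast\mathbb 1\cong P$ satisfying the triangle axiom. Moreover there is a morphism $\pi:\mathrm{Hom}_{\mathcal S}(-,FF^{\diamond})\to\mathbb 1$ which is a coequalizer in $[\mathcal S^{\mathrm{op}},\mathbf{Vec}_k]$ of the pair $$\mathrm{Hom}_{\mathcal S}(-,(FF^{\diamond})(FF^{\diamond}))\rightrightarrows\mathrm{Hom}_{\mathcal S}(-,FF^{\diamond})$$ given by postcomposition with $$(\varepsilon^{F,r}_F\,F^{\diamond})\circ a^{-1}_{FF^\diamond,F,F^\diamond}\quad\text{and}\quad (F\,\varepsilon^{F,l}_{F^{\diamond}})\circ a_{F,F^\diamond,FF^\diamond},$$ so that $\mathbb 1\cong\mathrm{Coeq}\big(\mathrm{Hom}(-,\varepsilon^{F,r}_FF^{\diamond}),\ \mathrm{Hom}(-,F\varepsilon^{F,l}_{F^{\diamond}})\big)$. -/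

import Mathlib

open CategoryTheory Opposite TensorProduct

universe w v u

noncomputable section

/-! ## Semigroup categories -/

/-- A semigroup category: a category with a tensor product bifunctor and an associativity
isomorphism satisfying the pentagon axiom (a "monoidal category without unit object").  As usual
the bifunctor is given by its action on objects and its two partial actions on morphisms. -/
class SemigroupCategory (C : Type u) [Category.{v} C] where
  tensorObj : C → C → C
  whiskerLeft (X : C) {Y Z : C} (f : Y ⟶ Z) : tensorObj X Y ⟶ tensorObj X Z
  whiskerRight {X Y : C} (f : X ⟶ Y) (Z : C) : tensorObj X Z ⟶ tensorObj Y Z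
  associator (X Y Z : C) : tensorObj (tensorObj X Y) Z ≅ tensorObj X (tensorObj Y Z)
  whiskerLeft_id (X Y : C) : whiskerLeft X (𝟙 Y) = 𝟙 (tensorObj X Y)
  whiskerLeft_comp (W : C) {X Y Z : C} (f : X ⟶ Y) (g : Y ⟶ Z) :
    whiskerLeft W (f ≫ g) = whiskerLeft W f ≫ whiskerLeft W g
  id_whiskerRight (X Y : C) : whiskerRight (𝟙 X) Y = 𝟙 (tensorObj X Y)
  comp_whiskerRight {X Y Z : C} (f : X ⟶ Y) (g : Y ⟶ Z) (W : C) :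
    whiskerRight (f ≫ g) W = whiskerRight f W ≫ whiskerRight g W
  whisker_exchange {X Y X' Y' : C} (f : X ⟶ Y) (g : X' ⟶ Y') :
    whiskerLeft X g ≫ whiskerRight f Y' = whiskerRight f X' ≫ whiskerLeft Y g
  associator_naturality_left {X X' : C} (f : X ⟶ X') (Y Z : C) :
    whiskerRight (whiskerRight f Y) Z ≫ (associator X' Y Z).hom =
      (associator X Y Z).hom ≫ whiskerRight f (tensorObj Y Z)
  associator_naturality_middle (X : C) {Y Y' : C} (f : Y ⟶ Y') (Z : C) :
    whiskerRight (whiskerLeft X f) Z ≫ (associator X Y' Z).hom =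
      (associator X Y Z).hom ≫ whiskerLeft X (whiskerRight f Z)
  associator_naturality_right (X Y : C) {Z Z' : C} (f : Z ⟶ Z') :
    whiskerLeft (tensorObj X Y) f ≫ (associator X Y Z').hom =
      (associator X Y Z).hom ≫ whiskerLeft X (whiskerLeft Y f)
  pentagon (W X Y Z : C) :
    whiskerRight (associator W X Y).hom Z ≫ (associator W (tensorObj X Y) Z).hom ≫
        whiskerLeft W (associator X Y Z).hom =
      (associator (tensorObj W X) Y Z).hom ≫ (associator W X (tensorObj Y Z)).hom

infixr:70 " ⊠ " => SemigroupCategory.tensorObj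
infixr:81 " ◁ₛ " => SemigroupCategory.whiskerLeft
infixl:81 " ▷ₛ " => SemigroupCategory.whiskerRight
notation "aₛ" => SemigroupCategory.associator

/-- A semigroup category is `k`-linear if its tensor product is `k`-bilinear on morphisms. -/
class LinearSemigroupCategory (k : Type w) [Semiring k] (C : Type u) [Category.{v} C]
    [Preadditive C] [Linear k C] [SemigroupCategory C] : Prop where
  whiskerLeft_add (X : C) {Y Z : C} (f g : Y ⟶ Z) : X ◁ₛ (f + g) = X ◁ₛ f + X ◁ₛ g
  add_whiskerRight {X Y : C} (f g : X ⟶ Y) (Z : C) : (f + g) ▷ₛ Z = f ▷ₛ Z + g ▷ₛ Z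
  whiskerLeft_smul (X : C) {Y Z : C} (r : k) (f : Y ⟶ Z) : X ◁ₛ (r • f) = r • (X ◁ₛ f)
  smul_whiskerRight {X Y : C} (r : k) (f : X ⟶ Y) (Z : C) : (r • f) ▷ₛ Z = r • (f ▷ₛ Z)

namespace SemigroupCategory

section Basic

variable {C : Type u} [Category.{v} C] [SemigroupCategory C]

theorem associator_inv_naturality_left {X X' : C} (f : X ⟶ X') (Y Z : C) :
    f ▷ₛ (Y ⊠ Z) ≫ (aₛ X' Y Z).inv = (aₛ X Y Z).inv ≫ f ▷ₛ Y ▷ₛ Z := by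
  rw [Iso.eq_inv_comp, ← Category.assoc, ← associator_naturality_left, Category.assoc,
    Iso.hom_inv_id, Category.comp_id]

theorem associator_inv_naturality_middle (X : C) {Y Y' : C} (f : Y ⟶ Y') (Z : C) :
    X ◁ₛ f ▷ₛ Z ≫ (aₛ X Y' Z).inv = (aₛ X Y Z).inv ≫ (X ◁ₛ f) ▷ₛ Z := by
  rw [Iso.eq_inv_comp, ← Category.assoc, ← associator_naturality_middle, Category.assoc,
    Iso.hom_inv_id, Category.comp_id]

theorem associator_inv_naturality_right (X Y : C) {Z Z' : C} (f : Z ⟶ Z') :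
    X ◁ₛ Y ◁ₛ f ≫ (aₛ X Y Z').inv = (aₛ X Y Z).inv ≫ (X ⊠ Y) ◁ₛ f := by
  rw [Iso.eq_inv_comp, ← Category.assoc, ← associator_naturality_right, Category.assoc,
    Iso.hom_inv_id, Category.comp_id]

/-- The functor `F ⊠ -`. -/
@[simps]
def tensorLeft (F : C) : C ⥤ C where
  obj X := F ⊠ X
  map f := F ◁ₛ f
  map_id X := whiskerLeft_id F X
  map_comp f g := whiskerLeft_comp F f g

/-- A monoidal unit of a semigroup category: an object `I` with natural isomorphisms
`I ⊠ X ≅ X` and `X ⊠ I ≅ X` satisfying the triangle axiom, i.e. precisely the data and axioms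
which make the semigroup category a monoidal category with unit object `I`. -/
structure MonoidalUnit (I : C) where
  leftUnitor (X : C) : I ⊠ X ≅ X
  rightUnitor (X : C) : X ⊠ I ≅ X
  leftUnitor_naturality {X Y : C} (f : X ⟶ Y) :
    I ◁ₛ f ≫ (leftUnitor Y).hom = (leftUnitor X).hom ≫ f
  rightUnitor_naturality {X Y : C} (f : X ⟶ Y) :
    f ▷ₛ I ≫ (rightUnitor Y).hom = (rightUnitor X).hom ≫ f
  triangle (X Y : C) :
    (aₛ X I Y).hom ≫ X ◁ₛ (leftUnitor Y).hom = (rightUnitor X).hom ▷ₛ Y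

/-- The monoidal category obtained from a semigroup category and a monoidal unit of it. -/
@[reducible]
def MonoidalUnit.toMonoidalCategory {I : C} (U : MonoidalUnit I) : MonoidalCategory C where
  tensorObj := tensorObj
  whiskerLeft X _ _ f := X ◁ₛ f
  whiskerRight f X := f ▷ₛ X
  tensorHom {X₁ Y₁ X₂ Y₂} f g := f ▷ₛ X₂ ≫ Y₁ ◁ₛ g
  tensorUnit := I
  associator := associator
  leftUnitor := U.leftUnitor
  rightUnitor := U.rightUnitor
  tensorHom_def _ _ := rfl
  id_tensorHom_id X Y := by simp [id_whiskerRight, whiskerLeft_id]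
  tensorHom_comp_tensorHom f₁ f₂ g₁ g₂ := by
    simp only [comp_whiskerRight, whiskerLeft_comp, Category.assoc]
    rw [← Category.assoc (_ ◁ₛ f₂), whisker_exchange, Category.assoc]
  whiskerLeft_id := whiskerLeft_id
  id_whiskerRight := id_whiskerRight
  associator_naturality {X₁ X₂ X₃ Y₁ Y₂ Y₃} f₁ f₂ f₃ := by
    simp only [comp_whiskerRight, whiskerLeft_comp, Category.assoc]
    rw [associator_naturality_right, ← Category.assoc ((_ ◁ₛ f₂) ▷ₛ _),
      associator_naturality_middle, Category.assoc, ← Category.assoc (_ ▷ₛ _ ▷ₛ _),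
      associator_naturality_left, Category.assoc]
  leftUnitor_naturality := U.leftUnitor_naturality
  rightUnitor_naturality := U.rightUnitor_naturality
  pentagon := pentagon
  triangle := U.triangle

/-- An adjunction `(F, G, ηˡ, ηʳ, εˡ, εʳ)` in a semigroup category `C`, exhibiting `G` as a right
dual of `F` and `F` as a left dual of `G`.  It consists of

* left `C`-module transformations `ηˡ : Id ⟶ - ⊠ (G ⊠ F)` and `εˡ : - ⊠ (F ⊠ G) ⟶ Id`,
* right `C`-module transformations `ηʳ : Id ⟶ (G ⊠ F) ⊠ -` and `εʳ : (F ⊠ G) ⊠ - ⟶ Id`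

(the module functor structures being given by the associator), such that `(- ⊠ G) ⊣ (- ⊠ F)` via
`ηˡ, εˡ` and `(F ⊠ -) ⊣ (G ⊠ -)` via `ηʳ, εʳ`, and which satisfy the mixed zigzag equations and
the left-right compatibility. -/
structure SemigroupAdjunction (F G : C) where
  etaL (X : C) : X ⟶ X ⊠ (G ⊠ F)
  epsL (X : C) : X ⊠ (F ⊠ G) ⟶ X
  etaR (X : C) : X ⟶ (G ⊠ F) ⊠ X
  epsR (X : C) : (F ⊠ G) ⊠ X ⟶ X
  etaL_naturality {X Y : C} (f : X ⟶ Y) : f ≫ etaL Y = etaL X ≫ f ▷ₛ (G ⊠ F)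
  epsL_naturality {X Y : C} (f : X ⟶ Y) : f ▷ₛ (F ⊠ G) ≫ epsL Y = epsL X ≫ f
  etaR_naturality {X Y : C} (f : X ⟶ Y) : f ≫ etaR Y = etaR X ≫ (G ⊠ F) ◁ₛ f
  epsR_naturality {X Y : C} (f : X ⟶ Y) : (F ⊠ G) ◁ₛ f ≫ epsR Y = epsR X ≫ f
  /-- `ηˡ` is a transformation of left module functors. -/
  etaL_module (X Y : C) : etaL (X ⊠ Y) ≫ (aₛ X Y (G ⊠ F)).hom = X ◁ₛ etaL Y
  /-- `εˡ` is a transformation of left module functors. -/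
  epsL_module (X Y : C) : epsL (X ⊠ Y) = (aₛ X Y (F ⊠ G)).hom ≫ X ◁ₛ epsL Y
  /-- `ηʳ` is a transformation of right module functors. -/
  etaR_module (X Y : C) : etaR (X ⊠ Y) = etaR X ▷ₛ Y ≫ (aₛ (G ⊠ F) X Y).hom
  /-- `εʳ` is a transformation of right module functors. -/
  epsR_module (X Y : C) : (aₛ (F ⊠ G) X Y).hom ≫ epsR (X ⊠ Y) = epsR X ▷ₛ Y
  /-- First triangle identity for `(- ⊠ G) ⊣ (- ⊠ F)`. -/
  left_triangle_L (X : C) :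
    etaL X ▷ₛ G ≫ (aₛ X G F).inv ▷ₛ G ≫ (aₛ (X ⊠ G) F G).hom ≫ epsL (X ⊠ G) = 𝟙 (X ⊠ G)
  /-- Second triangle identity for `(- ⊠ G) ⊣ (- ⊠ F)`. -/
  right_triangle_L (X : C) :
    etaL (X ⊠ F) ≫ (aₛ (X ⊠ F) G F).inv ≫ (aₛ X F G).hom ▷ₛ F ≫ epsL X ▷ₛ F = 𝟙 (X ⊠ F)
  /-- First triangle identity for `(F ⊠ -) ⊣ (G ⊠ -)`. -/
  left_triangle_R (X : C) :
    F ◁ₛ etaR X ≫ F ◁ₛ (aₛ G F X).hom ≫ (aₛ F G (F ⊠ X)).inv ≫ epsR (F ⊠ X) = 𝟙 (F ⊠ X)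
  /-- Second triangle identity for `(F ⊠ -) ⊣ (G ⊠ -)`. -/
  right_triangle_R (X : C) :
    etaR (G ⊠ X) ≫ (aₛ G F (G ⊠ X)).hom ≫ G ◁ₛ (aₛ F G X).inv ≫ G ◁ₛ epsR X = 𝟙 (G ⊠ X)
  /-- The mixed zigzag equation on `F`. -/
  zigzag_F : etaL F ≫ (aₛ F G F).inv ≫ epsR F = 𝟙 F
  /-- The mixed zigzag equation on `G`. -/
  zigzag_G : etaR G ≫ (aₛ G F G).hom ≫ epsL G = 𝟙 G
  /-- Left-right compatibility of the units. -/
  eta_compat (H K : C) : H ◁ₛ etaR K ≫ (aₛ H (G ⊠ F) K).inv = etaL H ▷ₛ K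
  /-- Left-right compatibility of the counits. -/
  eps_compat (H K : C) : (aₛ H (F ⊠ G) K).hom ≫ H ◁ₛ epsR K = epsL H ▷ₛ K

variable (C) in
/-- A semigroup category is rigid if each of its objects has a right dual and a left dual. -/
def IsRigid : Prop :=
  ∀ F : C, (∃ G : C, Nonempty (SemigroupAdjunction F G)) ∧
    (∃ G : C, Nonempty (SemigroupAdjunction G F))

end Basic

end SemigroupCategory

/-! ## Liberal functors -/

/-- A functor `F : A ⥤ B` between preadditive categories is liberal if every object `Y` of `B` is
a direct summand of a finite direct sum of objects `F(X i)`.  A morphism from (to) the direct sum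
is a tuple of morphisms from (to) its summands; this formulation makes sense also if the direct sum
does not exist in `B`, where it says that the representable presheaf of `Y` is a direct summand of
the direct sum of those of the `F(X i)`. -/
def IsLiberal {A : Type*} {B : Type*} [Category* A] [Category* B] [Preadditive B]
    (F : A ⥤ B) : Prop :=
  ∀ Y : B, ∃ (n : ℕ) (X : Fin n → A) (i : ∀ j, Y ⟶ F.obj (X j)) (p : ∀ j, F.obj (X j) ⟶ Y),
    ∑ j, i j ≫ p j = 𝟙 Y

/-- In the presence of finite direct sums, liberality in terms of retracts of direct sums. -/
theorem isLiberal_iff_retract {A : Type*} {B : Type*} [Category* A] [Category* B] [Preadditive B]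
    [Limits.HasFiniteBiproducts B] (F : A ⥤ B) :
    IsLiberal F ↔ ∀ Y : B, ∃ (n : ℕ) (X : Fin n → A),
      Nonempty (Retract Y (Limits.biproduct fun j => F.obj (X j))) := by
  refine forall_congr' fun Y => exists_congr fun n => exists_congr fun X => ⟨?_, ?_⟩
  · rintro ⟨i, p, h⟩
    exact ⟨⟨Limits.biproduct.lift i, Limits.biproduct.desc p, by
      rw [Limits.biproduct.lift_desc, h]⟩⟩
  · rintro ⟨r⟩
    refine ⟨fun j => r.i ≫ Limits.biproduct.π _ j, fun j => Limits.biproduct.ι (fun j => F.obj (X j)) j ≫ r.r, ?_⟩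
    have h := r.retract
    rw [← Category.id_comp r.r, ← Limits.biproduct.total, Preadditive.sum_comp,
      Preadditive.comp_sum] at h
    simpa using h

/-! ## Linear presheaves -/

section Presheaf

variable (k : Type w) [Field k] (S : Type u) [SmallCategory S] [Preadditive S] [Linear k S]

/-- The property of a functor `Sᵒᵖ ⥤ Vec_k` of being `k`-linear. -/
def IsLinearPresheaf : ObjectProperty (Sᵒᵖ ⥤ ModuleCat.{u} k) := fun P =>
  (∀ {X Y : S} (f g : X ⟶ Y), P.map (f + g).op = P.map f.op + P.map g.op) ∧
    ∀ {X Y : S} (r : k) (f : X ⟶ Y), P.map (r • f).op = r • P.map f.op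

/-- The category `[Sᵒᵖ, Vec_k]` of `k`-linear presheaves on a small `k`-linear category `S`, with
all natural transformations as morphisms. -/
abbrev LinPresheaf := (IsLinearPresheaf k S).FullSubcategory

namespace LinPresheaf

variable {k S}

/-- The vector space `P(X)`. -/
def val (P : LinPresheaf k S) (X : S) : Type u := P.obj.obj (op X)

instance (P : LinPresheaf k S) (X : S) : AddCommGroup (P.val X) :=
  inferInstanceAs (AddCommGroup (P.obj.obj (op X)))

instance (P : LinPresheaf k S) (X : S) : Module k (P.val X) :=
  inferInstanceAs (Module k (P.obj.obj (op X)))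

/-- The linear map `P(f) : P(Y) → P(X)` for `f : X ⟶ Y`. -/
def res (P : LinPresheaf k S) {X Y : S} (f : X ⟶ Y) : P.val Y →ₗ[k] P.val X :=
  (P.obj.map f.op).hom

theorem res_id (P : LinPresheaf k S) (X : S) (x : P.val X) : P.res (𝟙 X) x = x := by
  simp only [res, op_id, P.obj.map_id]; rfl

theorem res_comp (P : LinPresheaf k S) {X Y Z : S} (f : X ⟶ Y) (g : Y ⟶ Z) (x : P.val Z) :
    P.res (f ≫ g) x = P.res f (P.res g x) := by
  simp only [res, op_comp, P.obj.map_comp]; rfl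

theorem res_add (P : LinPresheaf k S) {X Y : S} (f g : X ⟶ Y) (x : P.val Y) :
    P.res (f + g) x = P.res f x + P.res g x := by
  simp only [res, P.property.1 f g]; rfl

theorem res_smul (P : LinPresheaf k S) {X Y : S} (r : k) (f : X ⟶ Y) (x : P.val Y) :
    P.res (r • f) x = r • P.res f x := by
  simp only [res, P.property.2 r f]; rfl

/-- A linear presheaf from its values on objects and morphisms. -/
def mk' (M : S → Type u) [∀ X, AddCommGroup (M X)] [∀ X, Module k (M X)]
    (res : ∀ {X Y : S}, (X ⟶ Y) → (M Y →ₗ[k] M X))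
    (res_id : ∀ X (x : M X), res (𝟙 X) x = x)
    (res_comp : ∀ {X Y Z : S} (f : X ⟶ Y) (g : Y ⟶ Z) (x : M Z),
      res (f ≫ g) x = res f (res g x))
    (res_add : ∀ {X Y : S} (f g : X ⟶ Y) (x : M Y), res (f + g) x = res f x + res g x)
    (res_smul : ∀ {X Y : S} (r : k) (f : X ⟶ Y) (x : M Y), res (r • f) x = r • res f x) :
    LinPresheaf k S where
  obj :=
    { obj := fun X => ModuleCat.of k (M X.unop)
      map := fun f => ModuleCat.ofHom (res f.unop)
      map_id := fun X => by ext x; exact res_id X.unop x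
      map_comp := fun f g => by ext x; exact res_comp g.unop f.unop x }
  property := ⟨fun f g => by ext x; exact res_add f g x, fun r f => by ext x; exact res_smul r f x⟩

/-- The component `P(X) → Q(X)` of a morphism of presheaves. -/
def ap {P Q : LinPresheaf k S} (φ : P ⟶ Q) (X : S) : P.val X →ₗ[k] Q.val X :=
  (φ.hom.app (op X)).hom

theorem ap_res {P Q : LinPresheaf k S} (φ : P ⟶ Q) {X Y : S} (f : X ⟶ Y) (x : P.val Y) :
    ap φ X (P.res f x) = Q.res f (ap φ Y x) :=
  ConcreteCategory.congr_hom (φ.hom.naturality f.op) x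

theorem ap_id (P : LinPresheaf k S) (X : S) (x : P.val X) : ap (𝟙 P) X x = x := rfl

theorem ap_comp {P Q R : LinPresheaf k S} (φ : P ⟶ Q) (ψ : Q ⟶ R) (X : S) (x : P.val X) :
    ap (φ ≫ ψ) X x = ap ψ X (ap φ X x) := rfl

theorem ap_add {P Q : LinPresheaf k S} (φ ψ : P ⟶ Q) (X : S) (x : P.val X) :
    ap (φ + ψ) X x = ap φ X x + ap ψ X x := rfl

theorem ap_smul {P Q : LinPresheaf k S} (c : k) (φ : P ⟶ Q) (X : S) (x : P.val X) :
    ap (c • φ) X x = c • ap φ X x := rfl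

theorem ext_ap {P Q : LinPresheaf k S} {φ ψ : P ⟶ Q} (h : ∀ X x, ap φ X x = ap ψ X x) :
    φ = ψ := by
  apply ObjectProperty.hom_ext
  ext X x
  exact h X.unop x

/-- A morphism of presheaves from its components. -/
def homMk' {P Q : LinPresheaf k S} (app : ∀ X, P.val X →ₗ[k] Q.val X)
    (nat : ∀ {X Y : S} (f : X ⟶ Y) (x : P.val Y), app X (P.res f x) = Q.res f (app Y x)) :
    P ⟶ Q :=
  ObjectProperty.homMk
    { app := fun X => ModuleCat.ofHom (app X.unop)
      naturality := fun _ _ f => by ext x; exact nat f.unop x }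

theorem ap_homMk' {P Q : LinPresheaf k S} (app : ∀ X, P.val X →ₗ[k] Q.val X)
    (nat : ∀ {X Y : S} (f : X ⟶ Y) (x : P.val Y), app X (P.res f x) = Q.res f (app Y x))
    (X : S) (x : P.val X) : ap (homMk' app nat) X x = app X x := rfl

variable (k S) in
/-- The Yoneda embedding `S ⥤ [Sᵒᵖ, Vec_k]`, `X ↦ Hom(-, X)`. -/
def yo : S ⥤ LinPresheaf k S :=
  (IsLinearPresheaf k S).lift (linearYoneda k S) fun X =>
    ⟨fun f g => by ext x; exact Preadditive.add_comp _ _ _ f g x,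
      fun r f => by ext x; exact Linear.smul_comp _ _ _ r f x⟩

end LinPresheaf

end Presheaf

/-! ## Day convolution -/

section Day

open SemigroupCategory LinearSemigroupCategory

variable {k : Type w} [Field k] {S : Type u} [SmallCategory S] [Preadditive S] [Linear k S]
  [SemigroupCategory S]

namespace LinPresheaf

section Coend

variable (P Q : LinPresheaf k S) (X : S)

/-- The direct sum of the spaces `Hom(X, H ⊠ K) ⊗ P(H) ⊗ Q(K)` over all objects `H, K`. -/
abbrev DaySum : Type u :=
  DirectSum (S × S) fun i => (X ⟶ i.1 ⊠ i.2) ⊗[k] (P.val i.1 ⊗[k] Q.val i.2)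

open Classical in
/-- The inclusion of the summand with index `(H, K)`. -/
def daySumIncl (H K : S) : (X ⟶ H ⊠ K) ⊗[k] (P.val H ⊗[k] Q.val K) →ₗ[k] DaySum P Q X :=
  DirectSum.lof k (S × S) (fun i => (X ⟶ i.1 ⊠ i.2) ⊗[k] (P.val i.1 ⊗[k] Q.val i.2)) (H, K)

/-- The relations defining the coend: `(h ⊠ l) ∘ f ⊗ p ⊗ q = f ⊗ P(h)(p) ⊗ Q(l)(q)`. -/
def dayRel : Submodule k (DaySum P Q X) :=
  Submodule.span k {z | ∃ (H H' K K' : S) (h : H ⟶ H') (l : K ⟶ K') (f : X ⟶ H ⊠ K)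
    (p : P.val H') (q : Q.val K'),
    z = daySumIncl P Q X H' K' ((f ≫ h ▷ₛ K ≫ H' ◁ₛ l) ⊗ₜ (p ⊗ₜ q)) -
      daySumIncl P Q X H K (f ⊗ₜ (P.res h p ⊗ₜ Q.res l q))}

/-- The coend `∫^{H,K} Hom(X, H ⊠ K) ⊗ P(H) ⊗ Q(K)`, as the quotient of the direct sum by the
coend relations. -/
abbrev DayAt : Type u := DaySum P Q X ⧸ dayRel P Q X

/-- The class of `f ⊗ p ⊗ q` in the coend, as a trilinear map. -/
def dayAtMk (H K : S) : (X ⟶ H ⊠ K) →ₗ[k] P.val H →ₗ[k] Q.val K →ₗ[k] DayAt P Q X :=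
  (TensorProduct.lcurry (.id k) (P.val H) (Q.val K) (DayAt P Q X)).comp
    (TensorProduct.curry ((dayRel P Q X).mkQ.comp (daySumIncl P Q X H K)))

variable {P Q X}

theorem dayAtMk_apply {H K : S} (f : X ⟶ H ⊠ K) (p : P.val H) (q : Q.val K) :
    dayAtMk P Q X H K f p q = (dayRel P Q X).mkQ (daySumIncl P Q X H K (f ⊗ₜ (p ⊗ₜ q))) := rfl

theorem dayAtMk_rel {H H' K K' : S} (h : H ⟶ H') (l : K ⟶ K')
    (f : X ⟶ H ⊠ K) (p : P.val H') (q : Q.val K') :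
    dayAtMk P Q X _ _ (f ≫ h ▷ₛ K ≫ H' ◁ₛ l) p q =
      dayAtMk P Q X _ _ f (P.res h p) (Q.res l q) :=
  (Submodule.Quotient.eq _).2 (Submodule.subset_span ⟨H, H', K, K', h, l, f, p, q, rfl⟩)

theorem dayAt_ext {N : Type*} [AddCommGroup N] [Module k N] {φ ψ : DayAt P Q X →ₗ[k] N}
    (h : ∀ {H K : S} (f : X ⟶ H ⊠ K) (p : P.val H) (q : Q.val K),
      φ (dayAtMk P Q X _ _ f p q) = ψ (dayAtMk P Q X _ _ f p q)) : φ = ψ := by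
  classical
  refine Submodule.linearMap_qext _ (DirectSum.linearMap_ext _ fun i => ?_)
  refine TensorProduct.ext' fun f y => ?_
  induction y using TensorProduct.induction_on with
  | zero => simp
  | tmul p q => exact h f p q
  | add a b ha hb => rw [TensorProduct.tmul_add, map_add, map_add, ha, hb]

open Classical in
/-- The linear map out of the coend given by trilinear maps compatible with the relations. -/
def dayAtDesc {N : Type u} [AddCommGroup N] [Module k N]
    (b : ∀ H K : S, (X ⟶ H ⊠ K) →ₗ[k] P.val H →ₗ[k] Q.val K →ₗ[k] N)
    (hb : ∀ {H H' K K' : S} (h : H ⟶ H') (l : K ⟶ K') (f : X ⟶ H ⊠ K) (p : P.val H')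
      (q : Q.val K'), b H' K' (f ≫ h ▷ₛ K ≫ H' ◁ₛ l) p q = b H K f (P.res h p) (Q.res l q)) :
    DayAt P Q X →ₗ[k] N :=
  (dayRel P Q X).liftQ
    (DirectSum.toModule k (S × S) N fun i =>
      TensorProduct.lift ((TensorProduct.uncurry (.id k) (P.val i.1) (Q.val i.2) N).comp
        (b i.1 i.2))) (by
    refine Submodule.span_le.2 ?_
    rintro _ ⟨H, H', K, K', h, l, f, p, q, rfl⟩
    simp only [daySumIncl, SetLike.mem_coe, LinearMap.mem_ker, map_sub, DirectSum.toModule_lof]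
    exact sub_eq_zero.2 (hb h l f p q))

theorem dayAtDesc_mk {N : Type u} [AddCommGroup N] [Module k N]
    (b : ∀ H K : S, (X ⟶ H ⊠ K) →ₗ[k] P.val H →ₗ[k] Q.val K →ₗ[k] N)
    (hb : ∀ {H H' K K' : S} (h : H ⟶ H') (l : K ⟶ K') (f : X ⟶ H ⊠ K) (p : P.val H')
      (q : Q.val K'), b H' K' (f ≫ h ▷ₛ K ≫ H' ◁ₛ l) p q = b H K f (P.res h p) (Q.res l q))
    {H K : S} (f : X ⟶ H ⊠ K) (p : P.val H) (q : Q.val K) :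
    dayAtDesc b hb (dayAtMk P Q X _ _ f p q) = b H K f p q := by
  classical
  rw [dayAtMk_apply]
  refine (Submodule.liftQ_apply _ _ _).trans ?_
  simp only [daySumIncl]
  exact (DirectSum.toModule_lof k (H, K) _).trans rfl

theorem dayAtRes_aux {X Y : S} (g : X ⟶ Y) {H H' K K' : S} (h : H ⟶ H') (l : K ⟶ K')
    (f : Y ⟶ H ⊠ K) (p : P.val H') (q : Q.val K') :
    (dayAtMk P Q X H' K').comp (Linear.leftComp k (H' ⊠ K') g) (f ≫ h ▷ₛ K ≫ H' ◁ₛ l) p q =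
      (dayAtMk P Q X H K).comp (Linear.leftComp k (H ⊠ K) g) f (P.res h p) (Q.res l q) := by
  simp only [LinearMap.comp_apply, Linear.leftComp_apply]
  rw [← dayAtMk_rel, Category.assoc]

variable (P Q) in
/-- Functoriality of the coend in `X`. -/
def dayAtRes {X Y : S} (g : X ⟶ Y) : DayAt P Q Y →ₗ[k] DayAt P Q X :=
  dayAtDesc (fun H K => (dayAtMk P Q X H K).comp (Linear.leftComp k (H ⊠ K) g)) (dayAtRes_aux g)

theorem dayAtRes_mk {X Y : S} (g : X ⟶ Y) {H K : S} (f : Y ⟶ H ⊠ K) (p : P.val H)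
    (q : Q.val K) :
    dayAtRes P Q g (dayAtMk P Q Y _ _ f p q) = dayAtMk P Q X _ _ (g ≫ f) p q :=
  dayAtDesc_mk (fun H K => (dayAtMk P Q X H K).comp (Linear.leftComp k (H ⊠ K) g)) (dayAtRes_aux g) f p q

end Coend

/-- The Day convolution of two presheaves,
`(P ⊛ Q)(X) = ∫^{H,K} Hom(X, H ⊠ K) ⊗ P(H) ⊗ Q(K)`. -/
def day (P Q : LinPresheaf k S) : LinPresheaf k S :=
  mk' (DayAt P Q) (dayAtRes P Q)
    (fun X x => by
      refine LinearMap.congr_fun (g := LinearMap.id) (dayAt_ext fun f p q => ?_) x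
      simp [dayAtRes_mk])
    (fun {X Y Z} f g x => by
      refine LinearMap.congr_fun (g := (dayAtRes P Q f).comp (dayAtRes P Q g))
        (dayAt_ext fun f p q => ?_) x
      simp [dayAtRes_mk])
    (fun {X Y} f g x => by
      refine LinearMap.congr_fun (g := dayAtRes P Q f + dayAtRes P Q g)
        (dayAt_ext fun f p q => ?_) x
      simp [dayAtRes_mk])
    (fun {X Y} r f x => by
      refine LinearMap.congr_fun (g := r • dayAtRes P Q f) (dayAt_ext fun f p q => ?_) x
      simp [dayAtRes_mk])

/-- The element `f ⊗ p ⊗ q` of `(P ⊛ Q)(X)`, as a trilinear map. -/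
def dayMkL (P Q : LinPresheaf k S) (X H K : S) :
    (X ⟶ H ⊠ K) →ₗ[k] P.val H →ₗ[k] Q.val K →ₗ[k] (day P Q).val X :=
  dayAtMk P Q X H K

/-- The element `f ⊗ p ⊗ q` of `(P ⊛ Q)(X)`. -/
def dayMk {P Q : LinPresheaf k S} {X H K : S} (f : X ⟶ H ⊠ K) (p : P.val H) (q : Q.val K) :
    (day P Q).val X :=
  dayMkL P Q X H K f p q

section Elements

variable {P Q R : LinPresheaf k S} {X H K : S}

theorem dayMkL_apply (f : X ⟶ H ⊠ K) (p : P.val H) (q : Q.val K) :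
    dayMkL P Q X H K f p q = dayMk f p q := rfl

theorem dayMk_add_hom (f g : X ⟶ H ⊠ K) (p : P.val H) (q : Q.val K) :
    dayMk (f + g) p q = dayMk f p q + dayMk g p q := by simp [dayMk]

theorem dayMk_smul_hom (r : k) (f : X ⟶ H ⊠ K) (p : P.val H) (q : Q.val K) :
    dayMk (r • f) p q = r • dayMk f p q := by simp [dayMk]

theorem dayMk_add_left (f : X ⟶ H ⊠ K) (p p' : P.val H) (q : Q.val K) :
    dayMk f (p + p') q = dayMk f p q + dayMk f p' q := by simp [dayMk]

theorem dayMk_smul_left (r : k) (f : X ⟶ H ⊠ K) (p : P.val H) (q : Q.val K) :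
    dayMk f (r • p) q = r • dayMk f p q := by simp [dayMk]

theorem dayMk_add_right (f : X ⟶ H ⊠ K) (p : P.val H) (q q' : Q.val K) :
    dayMk f p (q + q') = dayMk f p q + dayMk f p q' := by simp [dayMk]

theorem dayMk_smul_right (r : k) (f : X ⟶ H ⊠ K) (p : P.val H) (q : Q.val K) :
    dayMk f p (r • q) = r • dayMk f p q := by simp [dayMk]

theorem res_dayMk {Y : S} (g : Y ⟶ X) (f : X ⟶ H ⊠ K) (p : P.val H) (q : Q.val K) :
    (day P Q).res g (dayMk f p q) = dayMk (g ≫ f) p q :=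
  dayAtRes_mk g f p q

theorem dayMk_res_left {H' : S} (h : H ⟶ H') (f : X ⟶ H ⊠ K) (p : P.val H') (q : Q.val K) :
    dayMk f (P.res h p) q = dayMk (f ≫ h ▷ₛ K) p q := by
  have : dayMk (f ≫ h ▷ₛ K ≫ H' ◁ₛ 𝟙 K) p q = dayMk f (P.res h p) (Q.res (𝟙 K) q) :=
    dayAtMk_rel h (𝟙 K) f p q
  rw [whiskerLeft_id, Category.comp_id, res_id] at this
  exact this.symm

theorem dayMk_res_right {K' : S} (l : K ⟶ K') (f : X ⟶ H ⊠ K) (p : P.val H) (q : Q.val K') :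
    dayMk f p (Q.res l q) = dayMk (f ≫ H ◁ₛ l) p q := by
  have : dayMk (f ≫ (𝟙 H) ▷ₛ K ≫ H ◁ₛ l) p q = dayMk f (P.res (𝟙 H) p) (Q.res l q) :=
    dayAtMk_rel (𝟙 H) l f p q
  rw [id_whiskerRight, Category.id_comp, res_id] at this
  exact this.symm

/-- Linear maps out of `(P ⊛ Q)(X)` are determined by their values on the `f ⊗ p ⊗ q`. -/
theorem day_linear_ext {N : Type*} [AddCommGroup N] [Module k N]
    {φ ψ : (day P Q).val X →ₗ[k] N}
    (h : ∀ {H K : S} (f : X ⟶ H ⊠ K) (p : P.val H) (q : Q.val K),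
      φ (dayMk f p q) = ψ (dayMk f p q)) : φ = ψ :=
  dayAt_ext (φ := φ) (ψ := ψ) h

theorem day_hom_ext {φ ψ : day P Q ⟶ R}
    (h : ∀ {X H K : S} (f : X ⟶ H ⊠ K) (p : P.val H) (q : Q.val K),
      ap φ _ (dayMk f p q) = ap ψ _ (dayMk f p q)) : φ = ψ :=
  ext_ap fun _ => LinearMap.congr_fun (day_linear_ext h)

theorem dayMk_mk_right {T U : LinPresheaf k S} {X H L K M : S} (f : X ⟶ H ⊠ L) (p : P.val H)
    (g : L ⟶ K ⊠ M) (q : T.val K) (r : U.val M) :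
    dayMk f p (dayMk g q r) = dayMk (f ≫ H ◁ₛ g) p (dayMk (𝟙 _) q r) := by
  rw [← dayMk_res_right, res_dayMk, Category.comp_id]

theorem dayMk_mk_left {T U : LinPresheaf k S} {X H L K M : S} (f : X ⟶ L ⊠ M)
    (g : L ⟶ H ⊠ K) (p : T.val H) (q : U.val K) (r : P.val M) :
    dayMk f (dayMk g p q) r = dayMk (f ≫ g ▷ₛ M) (dayMk (𝟙 _) p q) r := by
  rw [← dayMk_res_left, res_dayMk, Category.comp_id]

variable (P Q X) in
/-- A trilinear function on triples `f ⊗ p ⊗ q` compatible with the coend relations. -/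
structure DayCone (N : Type u) [AddCommGroup N] [Module k N] where
  fn {H K : S} : (X ⟶ H ⊠ K) → P.val H → Q.val K → N
  add₁ {H K : S} (f f' : X ⟶ H ⊠ K) (p : P.val H) (q : Q.val K) :
    fn (f + f') p q = fn f p q + fn f' p q
  smul₁ {H K : S} (c : k) (f : X ⟶ H ⊠ K) (p : P.val H) (q : Q.val K) :
    fn (c • f) p q = c • fn f p q
  add₂ {H K : S} (f : X ⟶ H ⊠ K) (p p' : P.val H) (q : Q.val K) :
    fn f (p + p') q = fn f p q + fn f p' q
  smul₂ {H K : S} (c : k) (f : X ⟶ H ⊠ K) (p : P.val H) (q : Q.val K) :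
    fn f (c • p) q = c • fn f p q
  add₃ {H K : S} (f : X ⟶ H ⊠ K) (p : P.val H) (q q' : Q.val K) :
    fn f p (q + q') = fn f p q + fn f p q'
  smul₃ {H K : S} (c : k) (f : X ⟶ H ⊠ K) (p : P.val H) (q : Q.val K) :
    fn f p (c • q) = c • fn f p q
  left {H H' K : S} (h : H ⟶ H') (f : X ⟶ H ⊠ K) (p : P.val H') (q : Q.val K) :
    fn f (P.res h p) q = fn (f ≫ h ▷ₛ K) p q
  right {H K K' : S} (l : K ⟶ K') (f : X ⟶ H ⊠ K) (p : P.val H) (q : Q.val K') :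
    fn f p (Q.res l q) = fn (f ≫ H ◁ₛ l) p q

namespace DayCone

variable {N : Type u} [AddCommGroup N] [Module k N] (c : DayCone P Q X N)

/-- The function of a cone as a trilinear map. -/
def lin (H K : S) : (X ⟶ H ⊠ K) →ₗ[k] P.val H →ₗ[k] Q.val K →ₗ[k] N where
  toFun f := LinearMap.mk₂ k (c.fn f) (c.add₂ f) (fun r => c.smul₂ r f) (c.add₃ f)
    (fun r => c.smul₃ r f)
  map_add' f g := LinearMap.ext₂ fun p q => c.add₁ f g p q
  map_smul' r f := LinearMap.ext₂ fun p q => c.smul₁ r f p q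

theorem lin_rel {H H' K K' : S} (h : H ⟶ H') (l : K ⟶ K') (f : X ⟶ H ⊠ K) (p : P.val H')
    (q : Q.val K') :
    c.lin H' K' (f ≫ h ▷ₛ K ≫ H' ◁ₛ l) p q = c.lin H K f (P.res h p) (Q.res l q) := by
  have := (c.left h f p (Q.res l q)).trans (c.right l _ p q)
  rw [Category.assoc] at this
  exact this.symm

/-- The induced linear map out of `(P ⊛ Q)(X)`. -/
def desc : (day P Q).val X →ₗ[k] N := dayAtDesc c.lin c.lin_rel

theorem desc_mk (f : X ⟶ H ⊠ K) (p : P.val H) (q : Q.val K) :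
    c.desc (dayMk f p q) = c.fn f p q :=
  dayAtDesc_mk c.lin c.lin_rel f p q

end DayCone

/-- The morphism `P ⊛ Q ⟶ R` induced by a natural family of cones. -/
def dayLift (c : ∀ X, DayCone P Q X (R.val X))
    (nat : ∀ {X Y H K : S} (g : X ⟶ Y) (f : Y ⟶ H ⊠ K) (p : P.val H) (q : Q.val K),
      (c X).fn (g ≫ f) p q = R.res g ((c Y).fn f p q)) : day P Q ⟶ R :=
  homMk' (fun X => (c X).desc) (fun {X Y} g x => by
    refine LinearMap.congr_fun (f := (c X).desc.comp ((day P Q).res g))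
        (g := (R.res g).comp (c Y).desc) (day_linear_ext fun f p q => ?_) x
    simp only [LinearMap.comp_apply, res_dayMk, DayCone.desc_mk, nat])

theorem dayLift_mk (c : ∀ X, DayCone P Q X (R.val X))
    (nat : ∀ {X Y H K : S} (g : X ⟶ Y) (f : Y ⟶ H ⊠ K) (p : P.val H) (q : Q.val K),
      (c X).fn (g ≫ f) p q = R.res g ((c Y).fn f p q))
    (f : X ⟶ H ⊠ K) (p : P.val H) (q : Q.val K) :
    ap (dayLift c nat) X (dayMk f p q) = (c X).fn f p q :=
  (c X).desc_mk f p q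

end Elements

/-- Functoriality of Day convolution. -/
def dayMap {P P' Q Q' : LinPresheaf k S} (φ : P ⟶ P') (ψ : Q ⟶ Q') : day P Q ⟶ day P' Q' :=
  dayLift
    (fun X =>
      { fn := fun {H K} f p q => dayMk f (ap φ H p) (ap ψ K q)
        add₁ := fun f f' p q => dayMk_add_hom f f' _ _
        smul₁ := fun r f p q => dayMk_smul_hom r f _ _
        add₂ := fun f p p' q => by rw [map_add, dayMk_add_left]
        smul₂ := fun r f p q => by rw [map_smul, dayMk_smul_left]
        add₃ := fun f p q q' => by rw [map_add, dayMk_add_right]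
        smul₃ := fun r f p q => by rw [map_smul, dayMk_smul_right]
        left := fun h f p q => by rw [ap_res, dayMk_res_left]
        right := fun l f p q => by rw [ap_res, dayMk_res_right] })
    (fun g f _ _ => (res_dayMk g f _ _).symm)

theorem dayMap_mk {P P' Q Q' : LinPresheaf k S} (φ : P ⟶ P') (ψ : Q ⟶ Q') {X H K : S}
    (f : X ⟶ H ⊠ K) (p : P.val H) (q : Q.val K) :
    ap (dayMap φ ψ) X (dayMk f p q) = dayMk f (ap φ H p) (ap ψ K q) :=
  dayLift_mk _ (fun g f _ _ => (res_dayMk g f _ _).symm) f p q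

theorem dayMap_add_right (P : LinPresheaf k S) {Q R : LinPresheaf k S} (φ ψ : Q ⟶ R) :
    dayMap (𝟙 P) (φ + ψ) = dayMap (𝟙 P) φ + dayMap (𝟙 P) ψ :=
  day_hom_ext fun f p q => by
    rw [ap_add, dayMap_mk, dayMap_mk, dayMap_mk, ap_add, dayMk_add_right]

theorem dayMap_add_left {P R : LinPresheaf k S} (φ ψ : P ⟶ R) (Q : LinPresheaf k S) :
    dayMap (φ + ψ) (𝟙 Q) = dayMap φ (𝟙 Q) + dayMap ψ (𝟙 Q) :=
  day_hom_ext fun f p q => by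
    rw [ap_add, dayMap_mk, dayMap_mk, dayMap_mk, ap_add, dayMk_add_left]

theorem dayMap_smul_right (P : LinPresheaf k S) {Q R : LinPresheaf k S} (c : k) (φ : Q ⟶ R) :
    dayMap (𝟙 P) (c • φ) = c • dayMap (𝟙 P) φ :=
  day_hom_ext fun f p q => by
    rw [ap_smul, dayMap_mk, dayMap_mk, ap_smul, dayMk_smul_right]

theorem dayMap_smul_left {P R : LinPresheaf k S} (c : k) (φ : P ⟶ R) (Q : LinPresheaf k S) :
    dayMap (c • φ) (𝟙 Q) = c • dayMap φ (𝟙 Q) :=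
  day_hom_ext fun f p q => by
    rw [ap_smul, dayMap_mk, dayMap_mk, ap_smul, dayMk_smul_left]

theorem day_hom_ext₃ {P Q R T : LinPresheaf k S} {φ ψ : day (day P Q) R ⟶ T}
    (h : ∀ {X L H K M : S} (f : X ⟶ L ⊠ M) (g : L ⟶ H ⊠ K) (p : P.val H) (q : Q.val K)
      (r : R.val M), ap φ X (dayMk f (dayMk g p q) r) = ap ψ X (dayMk f (dayMk g p q) r)) :
    φ = ψ :=
  day_hom_ext fun {X L M} f x r => LinearMap.congr_fun
    (f := (ap φ X).comp ((dayMkL (day P Q) R X L M f).flip r))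
    (g := (ap ψ X).comp ((dayMkL (day P Q) R X L M f).flip r))
    (day_linear_ext fun g p q => h f g p q r) x

theorem day_hom_ext₃' {P Q R T : LinPresheaf k S} {φ ψ : day P (day Q R) ⟶ T}
    (h : ∀ {X L H K M : S} (f : X ⟶ H ⊠ L) (p : P.val H) (g : L ⟶ K ⊠ M) (q : Q.val K)
      (r : R.val M), ap φ X (dayMk f p (dayMk g q r)) = ap ψ X (dayMk f p (dayMk g q r))) :
    φ = ψ :=
  day_hom_ext fun {X H L} f p x => LinearMap.congr_fun
    (f := (ap φ X).comp (dayMkL P (day Q R) X H L f p))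
    (g := (ap ψ X).comp (dayMkL P (day Q R) X H L f p))
    (day_linear_ext fun g q r => h f p g q r) x

theorem day_hom_ext₄ {P Q R U T : LinPresheaf k S} {φ ψ : day (day (day P Q) R) U ⟶ T}
    (h : ∀ {X Y L H K M N : S} (f : X ⟶ Y ⊠ N) (g : Y ⟶ L ⊠ M) (e : L ⟶ H ⊠ K) (p : P.val H)
      (q : Q.val K) (r : R.val M) (s : U.val N),
      ap φ X (dayMk f (dayMk g (dayMk e p q) r) s) =
        ap ψ X (dayMk f (dayMk g (dayMk e p q) r) s)) : φ = ψ :=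
  day_hom_ext₃ fun {X Y L M N} f g x r s => LinearMap.congr_fun
    (f := (ap φ X).comp (((dayMkL (day (day P Q) R) U X Y N f).flip s).comp
      ((dayMkL (day P Q) R Y L M g).flip r)))
    (g := (ap ψ X).comp (((dayMkL (day (day P Q) R) U X Y N f).flip s).comp
      ((dayMkL (day P Q) R Y L M g).flip r)))
    (day_linear_ext fun e p q => h f g e p q r s) x

/-! ### The associator of Day convolution -/

variable [LinearSemigroupCategory k S]

section Associator

variable (P Q R : LinPresheaf k S)

/-- For fixed `f : X ⟶ L ⊠ M` and `r ∈ R(M)`, the linear map `(P ⊛ Q)(L) → (P ⊛ (Q ⊛ R))(X)`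
sending `g ⊗ p ⊗ q` to `(a ∘ (g ⊠ M) ∘ f) ⊗ p ⊗ (𝟙 ⊗ q ⊗ r)`. -/
def dayAssocHomAux {X L M : S} (f : X ⟶ L ⊠ M) (r : R.val M) :
    DayCone P Q L ((day P (day Q R)).val X) where
  fn {H K} g p q := dayMk (f ≫ g ▷ₛ M ≫ (aₛ H K M).hom) p (dayMk (𝟙 (K ⊠ M)) q r)
  add₁ g g' p q := by
    rw [add_whiskerRight (k := k), Preadditive.add_comp, Preadditive.comp_add, dayMk_add_hom]
  smul₁ c g p q := by
    rw [smul_whiskerRight, Linear.smul_comp, Linear.comp_smul, dayMk_smul_hom]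
  add₂ g p p' q := by rw [dayMk_add_left]
  smul₂ c g p q := by rw [dayMk_smul_left]
  add₃ g p q q' := by rw [dayMk_add_left, dayMk_add_right]
  smul₃ c g p q := by rw [dayMk_smul_left, dayMk_smul_right]
  left h g p q := by
    rw [dayMk_res_left, comp_whiskerRight]
    simp only [Category.assoc, associator_naturality_left]
  right {H K K'} l g p q := by
    rw [dayMk_res_left, dayMk_mk_right, comp_whiskerRight]
    simp only [Category.assoc, Category.id_comp, associator_naturality_middle]

theorem dayAssocHomAux_mk {X L M : S} (f : X ⟶ L ⊠ M) (r : R.val M)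
    {H K : S} (g : L ⟶ H ⊠ K) (p : P.val H) (q : Q.val K) :
    (dayAssocHomAux P Q R f r).desc (dayMk g p q) =
      dayMk (f ≫ g ▷ₛ M ≫ (aₛ H K M).hom) p (dayMk (𝟙 (K ⊠ M)) q r) :=
  (dayAssocHomAux P Q R f r).desc_mk g p q

/-- The cone defining the associator. -/
def dayAssocHomCone (X : S) : DayCone (day P Q) R X ((day P (day Q R)).val X) where
  fn f x r := (dayAssocHomAux P Q R f r).desc x
  add₁ f f' x r := by
    refine LinearMap.congr_fun
      (g := (dayAssocHomAux P Q R f r).desc + (dayAssocHomAux P Q R f' r).desc)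
      (day_linear_ext fun g p q => ?_) x
    simp only [LinearMap.add_apply, dayAssocHomAux_mk, Preadditive.add_comp, dayMk_add_hom]
  smul₁ c f x r := by
    refine LinearMap.congr_fun (g := c • (dayAssocHomAux P Q R f r).desc)
      (day_linear_ext fun g p q => ?_) x
    simp only [LinearMap.smul_apply, dayAssocHomAux_mk, Linear.smul_comp, dayMk_smul_hom]
  add₂ f x x' r := map_add _ x x'
  smul₂ c f x r := map_smul _ c x
  add₃ f x r r' := by
    refine LinearMap.congr_fun
      (g := (dayAssocHomAux P Q R f r).desc + (dayAssocHomAux P Q R f r').desc)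
      (day_linear_ext fun g p q => ?_) x
    simp only [LinearMap.add_apply, dayAssocHomAux_mk, dayMk_add_right]
  smul₃ c f x r := by
    refine LinearMap.congr_fun (g := c • (dayAssocHomAux P Q R f r).desc)
      (day_linear_ext fun g p q => ?_) x
    simp only [LinearMap.smul_apply, dayAssocHomAux_mk, dayMk_smul_right]
  left {L L' M} h f x r := by
    refine LinearMap.congr_fun
      (f := (dayAssocHomAux P Q R f r).desc.comp ((day P Q).res h))
      (day_linear_ext fun g p q => ?_) x
    simp only [LinearMap.comp_apply, res_dayMk, dayAssocHomAux_mk, comp_whiskerRight,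
      Category.assoc]
  right {L M M'} l f x r := by
    refine LinearMap.congr_fun (day_linear_ext fun {H K} g p q => ?_) x
    simp only [dayAssocHomAux_mk]
    rw [dayMk_res_right, dayMk_mk_right]
    simp only [Category.assoc, Category.id_comp]
    rw [← associator_naturality_right, ← Category.assoc (L ◁ₛ l), whisker_exchange,
      Category.assoc]

theorem dayAssocHomCone_mk {X L M H K : S} (f : X ⟶ L ⊠ M)
    (g : L ⟶ H ⊠ K) (p : P.val H) (q : Q.val K) (r : R.val M) :
    (dayAssocHomCone P Q R X).fn f (dayMk g p q) r =
      dayMk (f ≫ g ▷ₛ M ≫ (aₛ H K M).hom) p (dayMk (𝟙 (K ⊠ M)) q r) :=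
  dayAssocHomAux_mk P Q R f r g p q

theorem dayAssocHomCone_nat {X Y L M : S} (g : X ⟶ Y) (f : Y ⟶ L ⊠ M) (x : (day P Q).val L)
    (r : R.val M) :
    (dayAssocHomCone P Q R X).fn (g ≫ f) x r =
      (day P (day Q R)).res g ((dayAssocHomCone P Q R Y).fn f x r) := by
  refine LinearMap.congr_fun (f := (dayAssocHomAux P Q R (g ≫ f) r).desc)
    (g := ((day P (day Q R)).res g).comp (dayAssocHomAux P Q R f r).desc)
    (day_linear_ext fun {H K} e p q => ?_) x
  simp only [LinearMap.comp_apply, res_dayMk, dayAssocHomAux_mk, Category.assoc]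

/-- The morphism `(P ⊛ Q) ⊛ R ⟶ P ⊛ (Q ⊛ R)` sending `f ⊗ (g ⊗ p ⊗ q) ⊗ r` to
`(a ∘ (g ⊠ M) ∘ f) ⊗ p ⊗ (𝟙 ⊗ q ⊗ r)`, where `a` is the associator of `S`. -/
def dayAssocHom : day (day P Q) R ⟶ day P (day Q R) :=
  dayLift (dayAssocHomCone P Q R) (dayAssocHomCone_nat P Q R)

theorem dayAssocHom_mk {X L M H K : S} (f : X ⟶ L ⊠ M)
    (g : L ⟶ H ⊠ K) (p : P.val H) (q : Q.val K) (r : R.val M) :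
    ap (dayAssocHom P Q R) X (dayMk f (dayMk g p q) r) =
      dayMk (f ≫ g ▷ₛ M ≫ (aₛ H K M).hom) p (dayMk (𝟙 (K ⊠ M)) q r) :=
  (dayLift_mk _ (dayAssocHomCone_nat P Q R) f (dayMk g p q) r).trans
    (dayAssocHomCone_mk P Q R f g p q r)

/-- For fixed `f : X ⟶ H ⊠ L` and `p ∈ P(H)`, the linear map `(Q ⊛ R)(L) → ((P ⊛ Q) ⊛ R)(X)`
sending `g ⊗ q ⊗ r` to `(a⁻¹ ∘ (H ⊠ g) ∘ f) ⊗ (𝟙 ⊗ p ⊗ q) ⊗ r`. -/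
def dayAssocInvAux {X H L : S} (f : X ⟶ H ⊠ L) (p : P.val H) :
    DayCone Q R L ((day (day P Q) R).val X) where
  fn {K M} g q r := dayMk (f ≫ H ◁ₛ g ≫ (aₛ H K M).inv) (dayMk (𝟙 (H ⊠ K)) p q) r
  add₁ g g' q r := by
    rw [whiskerLeft_add (k := k), Preadditive.add_comp, Preadditive.comp_add, dayMk_add_hom]
  smul₁ c g q r := by
    rw [whiskerLeft_smul, Linear.smul_comp, Linear.comp_smul, dayMk_smul_hom]
  add₂ g q q' r := by rw [dayMk_add_right, dayMk_add_left]
  smul₂ c g q r := by rw [dayMk_smul_right, dayMk_smul_left]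
  add₃ g q r r' := by rw [dayMk_add_right]
  smul₃ c g q r := by rw [dayMk_smul_right]
  left h g q r := by
    rw [dayMk_res_right, dayMk_mk_left, whiskerLeft_comp]
    simp only [Category.assoc, Category.id_comp, associator_inv_naturality_middle]
  right l g q r := by
    rw [dayMk_res_right, whiskerLeft_comp]
    simp only [Category.assoc, associator_inv_naturality_right]

theorem dayAssocInvAux_mk {X H L : S} (f : X ⟶ H ⊠ L) (p : P.val H)
    {K M : S} (g : L ⟶ K ⊠ M) (q : Q.val K) (r : R.val M) :
    (dayAssocInvAux P Q R f p).desc (dayMk g q r) =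
      dayMk (f ≫ H ◁ₛ g ≫ (aₛ H K M).inv) (dayMk (𝟙 (H ⊠ K)) p q) r :=
  (dayAssocInvAux P Q R f p).desc_mk g q r

/-- The cone defining the inverse of the associator. -/
def dayAssocInvCone (X : S) : DayCone P (day Q R) X ((day (day P Q) R).val X) where
  fn f p x := (dayAssocInvAux P Q R f p).desc x
  add₁ f f' p x := by
    refine LinearMap.congr_fun
      (g := (dayAssocInvAux P Q R f p).desc + (dayAssocInvAux P Q R f' p).desc)
      (day_linear_ext fun g q r => ?_) x
    simp only [LinearMap.add_apply, dayAssocInvAux_mk, Preadditive.add_comp, dayMk_add_hom]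
  smul₁ c f p x := by
    refine LinearMap.congr_fun (g := c • (dayAssocInvAux P Q R f p).desc)
      (day_linear_ext fun g q r => ?_) x
    simp only [LinearMap.smul_apply, dayAssocInvAux_mk, Linear.smul_comp, dayMk_smul_hom]
  add₂ f p p' x := by
    refine LinearMap.congr_fun
      (g := (dayAssocInvAux P Q R f p).desc + (dayAssocInvAux P Q R f p').desc)
      (day_linear_ext fun g q r => ?_) x
    simp only [LinearMap.add_apply, dayAssocInvAux_mk, dayMk_add_left]
  smul₂ c f p x := by
    refine LinearMap.congr_fun (g := c • (dayAssocInvAux P Q R f p).desc)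
      (day_linear_ext fun g q r => ?_) x
    simp only [LinearMap.smul_apply, dayAssocInvAux_mk, dayMk_smul_left]
  add₃ f p x x' := map_add _ x x'
  smul₃ c f p x := map_smul _ c x
  left {H H' L} h f p x := by
    refine LinearMap.congr_fun (day_linear_ext fun {K M} g q r => ?_) x
    simp only [dayAssocInvAux_mk]
    rw [dayMk_res_left, dayMk_mk_left]
    simp only [Category.assoc, Category.id_comp]
    rw [← associator_inv_naturality_left, ← Category.assoc (H ◁ₛ g), whisker_exchange,
      Category.assoc]
  right {H L L'} l f p x := by
    refine LinearMap.congr_fun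
      (f := (dayAssocInvAux P Q R f p).desc.comp ((day Q R).res l))
      (day_linear_ext fun g q r => ?_) x
    simp only [LinearMap.comp_apply, res_dayMk, dayAssocInvAux_mk, whiskerLeft_comp,
      Category.assoc]

theorem dayAssocInvCone_mk {X L M H K : S} (f : X ⟶ H ⊠ L) (p : P.val H) (g : L ⟶ K ⊠ M)
    (q : Q.val K) (r : R.val M) :
    (dayAssocInvCone P Q R X).fn f p (dayMk g q r) =
      dayMk (f ≫ H ◁ₛ g ≫ (aₛ H K M).inv) (dayMk (𝟙 (H ⊠ K)) p q) r :=
  dayAssocInvAux_mk P Q R f p g q r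

theorem dayAssocInvCone_nat {X Y H L : S} (g : X ⟶ Y) (f : Y ⟶ H ⊠ L) (p : P.val H)
    (x : (day Q R).val L) :
    (dayAssocInvCone P Q R X).fn (g ≫ f) p x =
      (day (day P Q) R).res g ((dayAssocInvCone P Q R Y).fn f p x) := by
  refine LinearMap.congr_fun (f := (dayAssocInvAux P Q R (g ≫ f) p).desc)
    (g := ((day (day P Q) R).res g).comp (dayAssocInvAux P Q R f p).desc)
    (day_linear_ext fun {K M} e q r => ?_) x
  simp only [LinearMap.comp_apply, res_dayMk, dayAssocInvAux_mk, Category.assoc]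

/-- The morphism `P ⊛ (Q ⊛ R) ⟶ (P ⊛ Q) ⊛ R` sending `f ⊗ p ⊗ (g ⊗ q ⊗ r)` to
`(a⁻¹ ∘ (H ⊠ g) ∘ f) ⊗ (𝟙 ⊗ p ⊗ q) ⊗ r`, where `a` is the associator of `S`. -/
def dayAssocInv : day P (day Q R) ⟶ day (day P Q) R :=
  dayLift (dayAssocInvCone P Q R) (dayAssocInvCone_nat P Q R)

theorem dayAssocInv_mk {X L M H K : S} (f : X ⟶ H ⊠ L) (p : P.val H) (g : L ⟶ K ⊠ M)
    (q : Q.val K) (r : R.val M) :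
    ap (dayAssocInv P Q R) X (dayMk f p (dayMk g q r)) =
      dayMk (f ≫ H ◁ₛ g ≫ (aₛ H K M).inv) (dayMk (𝟙 (H ⊠ K)) p q) r :=
  (dayLift_mk _ (dayAssocInvCone_nat P Q R) f p (dayMk g q r)).trans
    (dayAssocInvCone_mk P Q R f p g q r)

/-- The associator of Day convolution. -/
def dayAssoc : day (day P Q) R ≅ day P (day Q R) where
  hom := dayAssocHom P Q R
  inv := dayAssocInv P Q R
  hom_inv_id := day_hom_ext₃ fun f g p q r => by
    rw [ap_comp, ap_id, dayAssocHom_mk, dayAssocInv_mk, dayMk_mk_left f]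
    simp only [whiskerLeft_id, Category.assoc, Category.id_comp, Iso.hom_inv_id,
      Category.comp_id]
  inv_hom_id := day_hom_ext₃' fun f p g q r => by
    rw [ap_comp, ap_id, dayAssocInv_mk, dayAssocHom_mk, dayMk_mk_right f]
    simp only [id_whiskerRight, Category.assoc, Category.id_comp, Iso.inv_hom_id,
      Category.comp_id]

end Associator

/-- The semigroup category `[Sᵒᵖ, Vec_k]` with Day convolution. -/
instance : SemigroupCategory (LinPresheaf k S) where
  tensorObj := day
  whiskerLeft P _ _ ψ := dayMap (𝟙 P) ψ
  whiskerRight φ Q := dayMap φ (𝟙 Q)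
  associator := dayAssoc
  whiskerLeft_id P Q := day_hom_ext fun f p q => by simp only [dayMap_mk, ap_id]
  whiskerLeft_comp P _ _ _ φ ψ := day_hom_ext fun f p q => by simp only [dayMap_mk, ap_comp, ap_id]
  id_whiskerRight P Q := day_hom_ext fun f p q => by simp only [dayMap_mk, ap_id]
  comp_whiskerRight φ ψ Q := day_hom_ext fun f p q => by simp only [dayMap_mk, ap_comp, ap_id]
  whisker_exchange φ ψ := day_hom_ext fun f p q => by simp only [dayMap_mk, ap_comp, ap_id]
  associator_naturality_left φ Q R := day_hom_ext₃ fun f g p q r => by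
    simp only [dayAssoc, dayMap_mk, dayAssocHom_mk, ap_comp, ap_id]
  associator_naturality_middle P _ _ φ R := day_hom_ext₃ fun f g p q r => by
    simp only [dayAssoc, dayMap_mk, dayAssocHom_mk, ap_comp, ap_id]
  associator_naturality_right P Q _ _ φ := day_hom_ext₃ fun f g p q r => by
    simp only [dayAssoc, dayMap_mk, dayAssocHom_mk, ap_comp, ap_id]
  pentagon P Q R T := day_hom_ext₄ fun {X Y L H K M N} f g e p q r s => by
    simp only [dayAssoc, dayMap_mk, dayAssocHom_mk, ap_comp, ap_id]
    rw [dayMk_mk_right]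
    simp only [comp_whiskerRight, id_whiskerRight, Category.assoc, Category.id_comp, pentagon]
    rw [← Category.assoc (e ▷ₛ M ▷ₛ N), associator_naturality_left, Category.assoc]

instance : LinearSemigroupCategory k (LinPresheaf k S) where
  whiskerLeft_add P _ _ φ ψ := dayMap_add_right P φ ψ
  add_whiskerRight φ ψ Q := dayMap_add_left φ ψ Q
  whiskerLeft_smul P _ _ c φ := dayMap_smul_right P c φ
  smul_whiskerRight c φ Q := dayMap_smul_left c φ Q

/-! ### The unit presheaf -/

variable (k S) in
/-- The space `Hom(X ⊠ -, Id)` of transformations of right `S`-module functors `X ⊠ - ⟶ Id`,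
i.e. of natural transformations `α` such that `α_{H ⊠ K} ∘ a = α_H ⊠ K`, where `a` is the
associator. -/
def moduleTransToId (X : S) : Submodule k (∀ H : S, X ⊠ H ⟶ H) where
  carrier := {α | (∀ {H K : S} (f : H ⟶ K), X ◁ₛ f ≫ α K = α H ≫ f) ∧
    ∀ H K : S, (aₛ X H K).hom ≫ α (H ⊠ K) = α H ▷ₛ K}
  add_mem' {α β} hα hβ := ⟨fun {H K} f => by
      rw [Pi.add_apply, Pi.add_apply, Preadditive.comp_add, Preadditive.add_comp, hα.1, hβ.1],
    fun H K => by
      rw [Pi.add_apply, Pi.add_apply, Preadditive.comp_add, add_whiskerRight (k := k), hα.2,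
        hβ.2]⟩
  zero_mem' := ⟨fun {H K} f => by simp, fun H K => by
    have h := smul_whiskerRight (k := k) (0 : k) (0 : X ⊠ H ⟶ H) K
    rw [zero_smul, zero_smul] at h
    simp [h]⟩
  smul_mem' c α hα := ⟨fun {H K} f => by
      rw [Pi.smul_apply, Pi.smul_apply, Linear.comp_smul, Linear.smul_comp, hα.1],
    fun H K => by
      rw [Pi.smul_apply, Pi.smul_apply, Linear.comp_smul, smul_whiskerRight, hα.2]⟩

variable (k S) in
/-- The presheaf `X ↦ Hom(X ⊠ -, Id)`, the space of transformations of right `S`-module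
functors. -/
def unitPresheaf : LinPresheaf k S :=
  mk' (fun X => moduleTransToId k S X)
    (fun {X Y} f =>
      { toFun := fun α => ⟨fun H => f ▷ₛ H ≫ α.1 H,
          fun {H K} g => by
            rw [← Category.assoc, whisker_exchange, Category.assoc, α.2.1, Category.assoc],
          fun H K => by
            rw [← Category.assoc, ← associator_naturality_left, Category.assoc, α.2.2,
              comp_whiskerRight]⟩
        map_add' := fun α β => Subtype.ext (funext fun H => Preadditive.comp_add _ _ _ _ _ _)
        map_smul' := fun c α => Subtype.ext (funext fun H => Linear.comp_smul _ _ _ _ _ _) })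
    (fun X α => Subtype.ext (funext fun H => by simp [id_whiskerRight]))
    (fun f g α => Subtype.ext (funext fun H => by simp [comp_whiskerRight]))
    (fun f g α => Subtype.ext (funext fun H => by
      simp [add_whiskerRight (k := k), Preadditive.add_comp]))
    (fun r f α => Subtype.ext (funext fun H => by
      simp [smul_whiskerRight, Linear.smul_comp]))

end LinPresheaf

end Day

end

noncomputable section

open SemigroupCategory LinearSemigroupCategory

namespace SemigroupCategory

/-! ### Left and right module transformations, and sections of the counits -/

section Semigroup

variable {C : Type u} [Category.{v} C] [SemigroupCategory C]

/-! Suppress associators, write G for the right dual of F, and let ε be the right counit FG ⊗ - →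
Id, regarded as an element of 𝟙(FG). The object FG substitutes for the missing unit object; three
facts make this work.

Both counits are split epimorphic. As F ⊗ - is liberal, each Y is a summand of a sum of objects F
X_j, where `zigzag_F` splits ε^r; naturality then splits ε^r_Y : (FG)Y → Y (`exists_section_epsR`).
Passing through a left dual of Y turns this into a splitting of ε^l_Y : Y(FG) → Y
(`exists_section_epsL`). The sections need not be natural.

Every right module transformation α : H ⊗ - → Id has a unique left counterpart β : - ⊗ H → Id with
β_L K = L α_K (`transpose_whiskerRight`, `trLeft_eq`). It is obtained from right duals; the
counterpart of ε^r is ε^l. The right unitor is defined with β, and the equation β_L K = L α_K is the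
triangle axiom.

The element ε generates 𝟙. Indeed α ∘ ε^r_H = ε ∘ β_{FG} in 𝟙((FG)H) (`res_epsR`), so composing with
a section of ε^r_H makes α a restriction of ε. The relation ε ∘ ε^l_{FG} = ε ∘ ε^r_{FG}
(`res_epsL_counitElt`) accounts for all ambiguity in such presentations. For the coequalizer, a
morphism f : X → FG satisfies f = ε^r_{FG} ∘ (FG)f ∘ s_X by naturality, while the presentation of
its image in 𝟙(X) obtained from s_X is ε^l_{FG} ∘ (FG)f ∘ s_X; a map coequalizing the pair
identifies the two. For the unitors, the same relation shows that g ⊗ ε ⊗ p in 𝟙 ⊛ P depends only on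
ε^r ∘ g and p, so that p ↦ s_X ⊗ ε ⊗ p inverts f ⊗ α ⊗ p ↦ P(α ∘ f)(p); the right side is the mirror
image. -/

theorem pentagon_inv_hom_hom (W X Y Z : C) :
    (aₛ (W ⊠ X) Y Z).inv ≫ (aₛ W X Y).hom ▷ₛ Z ≫ (aₛ W (X ⊠ Y) Z).hom =
      (aₛ W X (Y ⊠ Z)).hom ≫ W ◁ₛ (aₛ X Y Z).inv := by
  rw [Iso.inv_comp_eq, ← Category.assoc (aₛ (W ⊠ X) Y Z).hom, ← pentagon]
  simp only [Category.assoc]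
  rw [← whiskerLeft_comp, Iso.hom_inv_id, whiskerLeft_id, Category.comp_id]

theorem pentagon_inv_inv_hom (W X Y Z : C) :
    (aₛ W (X ⊠ Y) Z).inv ≫ (aₛ W X Y).inv ▷ₛ Z ≫ (aₛ (W ⊠ X) Y Z).hom =
      W ◁ₛ (aₛ X Y Z).hom ≫ (aₛ W X (Y ⊠ Z)).inv := by
  rw [← Category.assoc _ (_ ▷ₛ Z), Iso.eq_comp_inv, Category.assoc, Category.assoc, ← pentagon,
    ← Category.assoc (_ ▷ₛ Z), ← comp_whiskerRight, Iso.inv_hom_id, id_whiskerRight,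
    Category.id_comp, Iso.inv_hom_id_assoc]

/-- Morphisms into an object with a right dual are determined by their right whiskerings. -/
theorem SemigroupAdjunction.hom_ext_whiskerRight {A B M : C} (adj : SemigroupAdjunction B M)
    {u v : A ⟶ B} (h : ∀ K, u ▷ₛ K = v ▷ₛ K) : u = v := by
  -- The mixed zigzag factors the identity of `B` through `etaL B`, and naturality of `etaL` trades
  -- `u` for `u ▷ₛ (M ⊠ B)`.
  rw [← Category.comp_id u, ← Category.comp_id v, ← adj.zigzag_F, ← Category.assoc u,
    ← Category.assoc v, adj.etaL_naturality, adj.etaL_naturality, h]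

variable {L M H : C} (adj : SemigroupAdjunction L M)

/-- The morphism `L ⊠ H ⟶ L` corresponding to a transformation `H ⊠ - ⟶ Id` of right module
functors, for an object `L` with right dual `M`. -/
def SemigroupAdjunction.transpose (α : ∀ K : C, H ⊠ K ⟶ K) : L ⊠ H ⟶ L :=
  adj.etaL (L ⊠ H) ≫ (aₛ L H (M ⊠ L)).hom ≫ L ◁ₛ α (M ⊠ L) ≫ (aₛ L M L).inv ≫ adj.epsR L

/-- After whiskering with `K`, unit compatibility turns `etaL` into `etaR K`, and the module axioms
for `epsR` and `α` absorb `K` into their arguments. Naturality of `α` moves `etaR K` past it, where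
it cancels against `epsR` by a triangle identity. This is the compatibility behind the triangle
axiom. -/
theorem SemigroupAdjunction.transpose_whiskerRight {α : ∀ K : C, H ⊠ K ⟶ K}
    (nat : ∀ {K K' : C} (f : K ⟶ K'), H ◁ₛ f ≫ α K' = α K ≫ f)
    (mod : ∀ K K' : C, (aₛ H K K').hom ≫ α (K ⊠ K') = α K ▷ₛ K') (K : C) :
    adj.transpose α ▷ₛ K = (aₛ L H K).hom ≫ L ◁ₛ α K := by
  have hα : α ((M ⊠ L) ⊠ K) = (aₛ H (M ⊠ L) K).inv ≫ α (M ⊠ L) ▷ₛ K := by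
    rw [← mod, Iso.inv_hom_id_assoc]
  have hmid : (L ◁ₛ α (M ⊠ L)) ▷ₛ K =
      (aₛ L (H ⊠ (M ⊠ L)) K).hom ≫ L ◁ₛ α (M ⊠ L) ▷ₛ K ≫ (aₛ L (M ⊠ L) K).inv := by
    rw [← Category.assoc, ← associator_naturality_middle, Category.assoc, Iso.hom_inv_id,
      Category.comp_id]
  -- Insert the triangle identity at `K` after `L ◁ₛ α K`, then slide `etaR K` in front of `α` by
  -- naturality.
  have hr : L ◁ₛ α K = L ◁ₛ H ◁ₛ adj.etaR K ≫ L ◁ₛ (aₛ H (M ⊠ L) K).inv ≫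
      L ◁ₛ α (M ⊠ L) ▷ₛ K ≫ L ◁ₛ (aₛ M L K).hom ≫ (aₛ L M (L ⊠ K)).inv ≫
        adj.epsR (L ⊠ K) := by
    rw [← Category.comp_id (L ◁ₛ α K), ← adj.left_triangle_R K]
    simp only [← Category.assoc, ← whiskerLeft_comp]
    rw [← nat, hα]
    simp only [Category.assoc]
  simp only [transpose, comp_whiskerRight]
  rw [hmid, ← adj.eta_compat, ← adj.epsR_module]
  simp only [Category.assoc]
  have h₁ := pentagon_inv_hom_hom L H (M ⊠ L) K
  have h₂ := pentagon_inv_inv_hom L M L K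
  have h₃ := associator_naturality_right L H (adj.etaR K)
  rw [hr, ← Category.assoc (aₛ L H K).hom, ← h₃, Category.assoc,
    ← Category.assoc (aₛ L H ((M ⊠ L) ⊠ K)).hom, ← h₁,
    ← Category.assoc (L ◁ₛ (aₛ M L K).hom), ← h₂]
  simp only [Category.assoc]

/-- If `F ⊠ -` is liberal and `F` has a right dual, the right module counit is split
epimorphic. -/
theorem SemigroupAdjunction.exists_section_epsR [Preadditive C] {F G : C}
    (adj : SemigroupAdjunction F G) (hF : IsLiberal (tensorLeft F)) (Y : C) :
    ∃ s : Y ⟶ (F ⊠ G) ⊠ Y, s ≫ adj.epsR Y = 𝟙 Y := by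
  obtain ⟨n, X, i, p, h⟩ : ∃ (n : ℕ) (X : Fin n → C) (i : ∀ j, Y ⟶ F ⊠ X j)
    (p : ∀ j, F ⊠ X j ⟶ Y), ∑ j, i j ≫ p j = 𝟙 Y := hF Y
  -- By `zigzag_F` and the module axiom, the middle factor is a section of `epsR` at `F ⊠ X j`;
  -- naturality of `epsR` transports it along `p j`.
  refine ⟨∑ j, i j ≫ (adj.etaL F ≫ (aₛ F G F).inv) ▷ₛ X j ≫ (aₛ (F ⊠ G) F (X j)).hom ≫
    (F ⊠ G) ◁ₛ p j, ?_⟩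
  rw [Preadditive.sum_comp, ← h]
  refine Finset.sum_congr rfl fun j _ => ?_
  simp only [Category.assoc]
  rw [adj.epsR_naturality, ← Category.assoc (aₛ (F ⊠ G) F (X j)).hom, adj.epsR_module,
    ← Category.assoc (_ ▷ₛ X j), ← comp_whiskerRight, Category.assoc, adj.zigzag_F,
    id_whiskerRight, Category.id_comp]

/-- A section of the right module counit at a left dual of `Y` yields a section of the left
module counit at `Y`. -/
theorem SemigroupAdjunction.exists_section_epsL {F G L Y : C}
    (adj : SemigroupAdjunction F G) (adjY : SemigroupAdjunction L Y)
    (hL : ∃ s : L ⟶ (F ⊠ G) ⊠ L, s ≫ adj.epsR L = 𝟙 L) :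
    ∃ t : Y ⟶ Y ⊠ (F ⊠ G), t ≫ adj.epsL Y = 𝟙 Y := by
  obtain ⟨s, hs⟩ := hL
  -- This is the mate of `s`: create a copy of `L` by the unit, apply `s` to it, and evaluate `L`
  -- against the right-hand `Y`. After composition with `adj.epsL Y`, counit compatibility turns the
  -- latter into `adj.epsR L`, which cancels `s`; `zigzag_G` remains.
  refine ⟨adjY.etaR Y ≫ (aₛ Y L Y).hom ≫ Y ◁ₛ s ▷ₛ Y ≫ Y ◁ₛ (aₛ (F ⊠ G) L Y).hom ≫
    (aₛ Y (F ⊠ G) (L ⊠ Y)).inv ≫ adjY.epsL (Y ⊠ (F ⊠ G)), ?_⟩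
  simp only [Category.assoc]
  rw [← adjY.epsL_naturality, ← adj.eps_compat, Category.assoc, Iso.inv_hom_id_assoc,
    ← Category.assoc (Y ◁ₛ (aₛ (F ⊠ G) L Y).hom), ← whiskerLeft_comp, adj.epsR_module,
    ← Category.assoc (Y ◁ₛ s ▷ₛ Y), ← whiskerLeft_comp, ← comp_whiskerRight, hs,
    id_whiskerRight, whiskerLeft_id, Category.id_comp, adjY.zigzag_G]

end Semigroup

end SemigroupCategory

namespace LinPresheaf

/-! ### Pointwise description of morphisms of presheaves -/

section Iso

variable {k : Type w} [Field k] {S : Type u} [SmallCategory S] [Preadditive S] [Linear k S]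

/-- A morphism of linear presheaves with componentwise inverses is an isomorphism. -/
def isoOfInverse {P Q : LinPresheaf k S} (φ : P ⟶ Q) (inv : ∀ X, Q.val X →ₗ[k] P.val X)
    (h₁ : ∀ X x, inv X (ap φ X x) = x) (h₂ : ∀ X x, ap φ X (inv X x) = x) : P ≅ Q where
  hom := φ
  -- Naturality of the inverse is automatic, so inverses may be built from sections that are not
  -- natural.
  inv := homMk' inv fun {X Y} f x => by
    rw [← h₁ X (P.res f (inv Y x)), ap_res, h₂]
  hom_inv_id := ext_ap h₁
  inv_hom_id := ext_ap h₂

/-- Morphisms out of a representable presheaf commute with precomposition. -/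
theorem yo_ap_res {P : LinPresheaf k S} {Z : S} (ψ : (yo k S).obj Z ⟶ P) {X Y : S} (f : X ⟶ Y)
    (g : Y ⟶ Z) : ap ψ X (f ≫ g : X ⟶ Z) = P.res f (ap ψ Y g) :=
  ap_res ψ f g

end Iso

/-! ### Elements of the unit presheaf, their left counterparts, and the generator -/

section Unit

variable {k : Type w} [Field k] {S : Type u} [SmallCategory S] [Preadditive S] [Linear k S]
  [SemigroupCategory S] [LinearSemigroupCategory k S]

/-- The component `X ⊠ H ⟶ H` of an element of the unit presheaf. -/
def tr {X : S} (α : (unitPresheaf k S).val X) (H : S) : X ⊠ H ⟶ H :=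
  Subtype.val (p := (· ∈ moduleTransToId k S X)) α H

theorem tr_naturality {X : S} (α : (unitPresheaf k S).val X) {H K : S} (f : H ⟶ K) :
    X ◁ₛ f ≫ tr α K = tr α H ≫ f :=
  (Subtype.property (p := (· ∈ moduleTransToId k S X)) α).1 f

theorem tr_module {X : S} (α : (unitPresheaf k S).val X) (H K : S) :
    (aₛ X H K).hom ≫ tr α (H ⊠ K) = tr α H ▷ₛ K :=
  (Subtype.property (p := (· ∈ moduleTransToId k S X)) α).2 H K

theorem tr_res {X Y : S} (f : X ⟶ Y) (α : (unitPresheaf k S).val Y) (H : S) :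
    tr ((unitPresheaf k S).res f α) H = f ▷ₛ H ≫ tr α H := rfl

theorem tr_add {X : S} (α β : (unitPresheaf k S).val X) (H : S) :
    tr (α + β) H = tr α H + tr β H := rfl

theorem tr_smul {X : S} (c : k) (α : (unitPresheaf k S).val X) (H : S) :
    tr (c • α) H = c • tr α H := rfl

theorem tr_ext {X : S} {α β : (unitPresheaf k S).val X} (h : ∀ H, tr α H = tr β H) : α = β :=
  Subtype.ext (p := (· ∈ moduleTransToId k S X)) (funext h)

variable (k) in
/-- The right module counit of an adjunction, as an element of the unit presheaf. -/
def counitElt {F G : S} (adj : SemigroupAdjunction F G) : (unitPresheaf k S).val (F ⊠ G) :=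
  Subtype.mk (p := (· ∈ moduleTransToId k S (F ⊠ G))) adj.epsR
    ⟨adj.epsR_naturality, adj.epsR_module⟩

theorem tr_counitElt {F G : S} (adj : SemigroupAdjunction F G) (H : S) :
    tr (counitElt k adj) H = adj.epsR H := rfl

section Transpose

variable {D : S → S} (A : ∀ L, SemigroupAdjunction L (D L))

/-- The component at `L` of the left module transformation `- ⊠ H ⟶ Id` corresponding to an
element of the unit presheaf. -/
def trLeft {H : S} (α : (unitPresheaf k S).val H) (L : S) : L ⊠ H ⟶ L :=
  (A L).transpose (tr α)

theorem trLeft_whiskerRight {H : S} (α : (unitPresheaf k S).val H) (L K : S) :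
    trLeft A α L ▷ₛ K = (aₛ L H K).hom ≫ L ◁ₛ tr α K :=
  (A L).transpose_whiskerRight (tr_naturality α) (tr_module α) K

/-- Whiskerings detect equality of morphisms into `L`, so the left counterpart is independent of the
chosen duals, and its linearity and restriction properties reduce to those of `α`. -/
theorem trLeft_eq {H : S} (α : (unitPresheaf k S).val H) {L : S} {β : L ⊠ H ⟶ L}
    (h : ∀ K, β ▷ₛ K = (aₛ L H K).hom ≫ L ◁ₛ tr α K) : trLeft A α L = β :=
  (A L).hom_ext_whiskerRight fun K => by rw [trLeft_whiskerRight, h]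

theorem trLeft_add {H : S} (α β : (unitPresheaf k S).val H) (L : S) :
    trLeft A (α + β) L = trLeft A α L + trLeft A β L :=
  trLeft_eq A _ fun K => by
    rw [add_whiskerRight (k := k), trLeft_whiskerRight, trLeft_whiskerRight, tr_add,
      whiskerLeft_add (k := k), Preadditive.comp_add]

theorem trLeft_smul {H : S} (c : k) (α : (unitPresheaf k S).val H) (L : S) :
    trLeft A (c • α) L = c • trLeft A α L :=
  trLeft_eq A _ fun K => by
    rw [smul_whiskerRight, trLeft_whiskerRight, tr_smul, whiskerLeft_smul, Linear.comp_smul]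

theorem trLeft_res {H H' : S} (f : H ⟶ H') (α : (unitPresheaf k S).val H') (L : S) :
    trLeft A ((unitPresheaf k S).res f α) L = L ◁ₛ f ≫ trLeft A α L :=
  trLeft_eq A _ fun K => by
    rw [comp_whiskerRight, trLeft_whiskerRight, ← Category.assoc, associator_naturality_middle,
      Category.assoc, ← whiskerLeft_comp, tr_res]

theorem trLeft_naturality {H : S} (α : (unitPresheaf k S).val H) {L L' : S} (f : L ⟶ L') :
    f ▷ₛ H ≫ trLeft A α L' = trLeft A α L ≫ f :=
  (A L').hom_ext_whiskerRight fun K => by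
    rw [comp_whiskerRight, comp_whiskerRight, trLeft_whiskerRight, trLeft_whiskerRight,
      ← Category.assoc, associator_naturality_left, Category.assoc, Category.assoc,
      whisker_exchange]

/-- Left-right compatibility of the counits is exactly the characterization of the left counterpart.
-/
theorem trLeft_counitElt {F G : S} (adj : SemigroupAdjunction F G) (L : S) :
    trLeft A (counitElt k adj) L = adj.epsL L :=
  trLeft_eq A _ fun K => (adj.eps_compat L K).symm

/-- By the module axiom and naturality of `epsR`, applying the counit before `α` agrees with
applying it after `(F ⊠ G) ◁ₛ tr α K`, and the latter is a whiskering of `trLeft`. Restricted along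
a section of `adj.epsR H`, this shows that the counit element generates the unit presheaf. -/
theorem res_epsR {F G : S} (adj : SemigroupAdjunction F G) {H : S}
    (α : (unitPresheaf k S).val H) :
    (unitPresheaf k S).res (adj.epsR H) α =
      (unitPresheaf k S).res (trLeft A α (F ⊠ G)) (counitElt k adj) :=
  tr_ext fun K => by
    rw [tr_res, tr_res, trLeft_whiskerRight, tr_counitElt, Category.assoc, adj.epsR_naturality,
      ← adj.epsR_module, Category.assoc]

end Transpose

/-- The mirror image of `res_epsR`. Counit compatibility converts `epsL` into `epsR`, so the
transformation `α` itself appears instead of its left counterpart. -/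
theorem res_epsL {F G : S} (adj : SemigroupAdjunction F G) {H : S}
    (α : (unitPresheaf k S).val H) :
    (unitPresheaf k S).res (adj.epsL H) α =
      (unitPresheaf k S).res (tr α (F ⊠ G)) (counitElt k adj) :=
  tr_ext fun K => by
    rw [tr_res, tr_res, tr_counitElt, ← adj.eps_compat, ← tr_module, Category.assoc,
      Category.assoc, tr_naturality]

/-- The case of `res_epsL` where `α` is the counit element. It is the basic relation used for both
unitors and for the coequalizer. -/
theorem res_epsL_counitElt {F G : S} (adj : SemigroupAdjunction F G) :
    (unitPresheaf k S).res (adj.epsL (F ⊠ G)) (counitElt k adj) =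
      (unitPresheaf k S).res (adj.epsR (F ⊠ G)) (counitElt k adj) :=
  res_epsL adj _

/-! ### The unitors -/

/-- The cone defining the left unitor. -/
def leftUnitCone (P : LinPresheaf k S) (X : S) :
    DayCone (unitPresheaf k S) P X (P.val X) where
  fn {_ K} f α p := P.res (f ≫ tr α K) p
  add₁ f f' α p := by rw [Preadditive.add_comp, res_add]
  smul₁ c f α p := by rw [Linear.smul_comp, res_smul]
  add₂ f α α' p := by rw [tr_add, Preadditive.comp_add, res_add]
  smul₂ c f α p := by rw [tr_smul, Linear.comp_smul, res_smul]
  add₃ f α p p' := map_add _ _ _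
  smul₃ c f α p := map_smul _ _ _
  left h f α p := by rw [tr_res, Category.assoc]
  right l f α p := by
    rw [← res_comp, Category.assoc, Category.assoc, tr_naturality]

theorem leftUnitCone_nat (P : LinPresheaf k S) {X Y H K : S} (g : X ⟶ Y) (f : Y ⟶ H ⊠ K)
    (α : (unitPresheaf k S).val H) (p : P.val K) :
    (leftUnitCone P X).fn (g ≫ f) α p = P.res g ((leftUnitCone P Y).fn f α p) := by
  simp only [leftUnitCone, res_comp]

/-- The morphism `𝟙 ⊛ P ⟶ P` sending `f ⊗ α ⊗ p` to `P(α ∘ f)(p)`. -/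
def leftUnitHom (P : LinPresheaf k S) : day (unitPresheaf k S) P ⟶ P :=
  dayLift (leftUnitCone P) (leftUnitCone_nat P)

theorem leftUnitHom_mk (P : LinPresheaf k S) {X H K : S} (f : X ⟶ H ⊠ K)
    (α : (unitPresheaf k S).val H) (p : P.val K) :
    ap (leftUnitHom P) X (dayMk f α p) = P.res (f ≫ tr α K) p :=
  dayLift_mk _ (leftUnitCone_nat P) f α p

section RightUnit

variable {D : S → S} (A : ∀ L, SemigroupAdjunction L (D L))

/-- The cone defining the right unitor. -/
def rightUnitCone (P : LinPresheaf k S) (X : S) :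
    DayCone P (unitPresheaf k S) X (P.val X) where
  fn {H _} f p α := P.res (f ≫ trLeft A α H) p
  add₁ f f' p α := by rw [Preadditive.add_comp, res_add]
  smul₁ c f p α := by rw [Linear.smul_comp, res_smul]
  add₂ f p p' α := map_add _ _ _
  smul₂ c f p α := map_smul _ _ _
  add₃ f p α α' := by rw [trLeft_add, Preadditive.comp_add, res_add]
  smul₃ c f p α := by rw [trLeft_smul, Linear.comp_smul, res_smul]
  left h f p α := by
    rw [← res_comp, Category.assoc, Category.assoc, trLeft_naturality]
  right l f p α := by rw [trLeft_res, Category.assoc]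

theorem rightUnitCone_nat (P : LinPresheaf k S) {X Y H K : S} (g : X ⟶ Y) (f : Y ⟶ H ⊠ K)
    (p : P.val H) (α : (unitPresheaf k S).val K) :
    (rightUnitCone A P X).fn (g ≫ f) p α = P.res g ((rightUnitCone A P Y).fn f p α) := by
  simp only [rightUnitCone, res_comp]

/-- The morphism `P ⊛ 𝟙 ⟶ P` sending `f ⊗ p ⊗ α` to `P(β ∘ f)(p)`, where `β` is the left module
transformation corresponding to `α`. -/
def rightUnitHom (P : LinPresheaf k S) : day P (unitPresheaf k S) ⟶ P :=
  dayLift (rightUnitCone A P) (rightUnitCone_nat A P)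

theorem rightUnitHom_mk (P : LinPresheaf k S) {X H K : S} (f : X ⟶ H ⊠ K) (p : P.val H)
    (α : (unitPresheaf k S).val K) :
    ap (rightUnitHom A P) X (dayMk f p α) = P.res (f ≫ trLeft A α H) p :=
  dayLift_mk _ (rightUnitCone_nat A P) f p α

end RightUnit

variable {F G : S} (adj : SemigroupAdjunction F G)

/-- Elements `g ⊗ ε ⊗ p` of `𝟙 ⊛ P` depend only on `ε ∘ g`. -/
theorem dayMk_counitElt_left {P : LinPresheaf k S} {X K : S} {s : X ⟶ (F ⊠ G) ⊠ X}
    (hs : s ≫ adj.epsR X = 𝟙 X) (g : X ⟶ (F ⊠ G) ⊠ K) (p : P.val K) :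
    dayMk g (counitElt k adj) p =
      dayMk (s ≫ (F ⊠ G) ◁ₛ (g ≫ adj.epsR K)) (counitElt k adj) p := by
  -- Factoring `g` through `epsR (F ⊠ G) ▷ₛ K` lets the coend relation move this counit onto the
  -- generator, where it may be exchanged for `epsL (F ⊠ G)`. Moved back, it becomes `(F ⊠ G) ◁ₛ
  -- epsR K`.
  have h : g = (s ≫ (F ⊠ G) ◁ₛ g ≫ (aₛ (F ⊠ G) (F ⊠ G) K).inv) ≫
      adj.epsR (F ⊠ G) ▷ₛ K := by
    simp only [Category.assoc]
    rw [← adj.epsR_module, Iso.inv_hom_id_assoc, adj.epsR_naturality, ← Category.assoc, hs,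
      Category.id_comp]
  conv_lhs => rw [h]
  rw [← dayMk_res_left, ← res_epsL_counitElt, dayMk_res_left, ← adj.eps_compat,
    whiskerLeft_comp]
  simp only [Category.assoc, Iso.inv_hom_id_assoc]

/-- Elements `g ⊗ p ⊗ ε` of `P ⊛ 𝟙` depend only on `ε ∘ g`. -/
theorem dayMk_counitElt_right {P : LinPresheaf k S} {X K : S} {t : X ⟶ X ⊠ (F ⊠ G)}
    (ht : t ≫ adj.epsL X = 𝟙 X) (g : X ⟶ K ⊠ (F ⊠ G)) (p : P.val K) :
    dayMk g p (counitElt k adj) =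
      dayMk (t ≫ (g ≫ adj.epsL K) ▷ₛ (F ⊠ G)) p (counitElt k adj) := by
  have h : g = (t ≫ g ▷ₛ (F ⊠ G) ≫ (aₛ K (F ⊠ G) (F ⊠ G)).hom) ≫
      K ◁ₛ adj.epsL (F ⊠ G) := by
    simp only [Category.assoc]
    rw [← adj.epsL_module, adj.epsL_naturality, ← Category.assoc, ht, Category.id_comp]
  conv_lhs => rw [h]
  rw [← dayMk_res_right, res_epsL_counitElt, dayMk_res_right, comp_whiskerRight,
    ← adj.eps_compat]
  simp only [Category.assoc]

/-- The left unitor `𝟙 ⊛ P ≅ P`. -/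
def leftUnitIso {D : S → S} (A : ∀ L, SemigroupAdjunction L (D L))
    (s : ∀ X, X ⟶ (F ⊠ G) ⊠ X) (hs : ∀ X, s X ≫ adj.epsR X = 𝟙 X) (P : LinPresheaf k S) :
    day (unitPresheaf k S) P ≅ P :=
  isoOfInverse (leftUnitHom P)
    (fun X => dayMkL (unitPresheaf k S) P X (F ⊠ G) X (s X) (counitElt k adj))
    (fun X x => by
      refine LinearMap.congr_fun (g := LinearMap.id)
        (f := (dayMkL (unitPresheaf k S) P X (F ⊠ G) X (s X) (counitElt k adj)).comp
          (ap (leftUnitHom P) X)) (day_linear_ext fun {H K} f α p => ?_) x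
      rw [LinearMap.comp_apply, leftUnitHom_mk, dayMkL_apply, dayMk_res_right,
        LinearMap.id_apply]
      -- Writing `α` as a restriction of the generator brings both sides to the form `g ⊗ ε ⊗ p`, so
      -- that only the composites of `g` with the counit need comparison.
      have hα : α = (unitPresheaf k S).res (s H ≫ trLeft A α (F ⊠ G)) (counitElt k adj) := by
        rw [res_comp, ← res_epsR, ← res_comp, hs, res_id]
      conv_rhs => rw [hα]
      rw [dayMk_res_left, dayMk_counitElt_left adj (hs X)]
      conv_rhs => rw [dayMk_counitElt_left adj (hs X)]
      have e : (f ≫ (s H ≫ trLeft A α (F ⊠ G)) ▷ₛ K) ≫ adj.epsR K = f ≫ tr α K := by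
        rw [Category.assoc, ← tr_counitElt (k := k) adj, ← tr_res, ← hα]
      rw [e, Category.assoc, adj.epsR_naturality, ← Category.assoc, hs, Category.id_comp])
    (fun X x => by
      rw [dayMkL_apply, leftUnitHom_mk, tr_counitElt, hs, res_id])

/-- The right unitor `P ⊛ 𝟙 ≅ P`. -/
def rightUnitIso {D : S → S} (A : ∀ L, SemigroupAdjunction L (D L))
    (t : ∀ X, X ⟶ X ⊠ (F ⊠ G)) (ht : ∀ X, t X ≫ adj.epsL X = 𝟙 X) (P : LinPresheaf k S) :
    day P (unitPresheaf k S) ≅ P :=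
  isoOfInverse (rightUnitHom A P)
    (fun X => (dayMkL P (unitPresheaf k S) X X (F ⊠ G) (t X)).flip (counitElt k adj))
    (fun X x => by
      refine LinearMap.congr_fun (g := LinearMap.id)
        (f := ((dayMkL P (unitPresheaf k S) X X (F ⊠ G) (t X)).flip (counitElt k adj)).comp
          (ap (rightUnitHom A P) X)) (day_linear_ext fun {H K} f p α => ?_) x
      rw [LinearMap.comp_apply, rightUnitHom_mk, LinearMap.flip_apply, dayMkL_apply,
        dayMk_res_left, LinearMap.id_apply]
      -- On this side a section of `epsL` presents `α` by means of `tr α`, and `trLeft` appears on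
      -- comparing composites with `epsL`.
      have hα : α = (unitPresheaf k S).res (t K ≫ tr α (F ⊠ G)) (counitElt k adj) := by
        rw [res_comp, ← res_epsL, ← res_comp, ht, res_id]
      conv_rhs => rw [hα]
      rw [dayMk_res_right, dayMk_counitElt_right adj (ht X)]
      conv_rhs => rw [dayMk_counitElt_right adj (ht X)]
      have e : (f ≫ H ◁ₛ (t K ≫ tr α (F ⊠ G))) ≫ adj.epsL H = f ≫ trLeft A α H := by
        rw [Category.assoc, ← trLeft_counitElt (k := k) A adj, ← trLeft_res, ← hα]
      rw [e, Category.assoc, adj.epsL_naturality, ← Category.assoc, ht, Category.id_comp])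
    (fun X x => by
      rw [LinearMap.flip_apply, dayMkL_apply, rightUnitHom_mk, trLeft_counitElt, ht, res_id])

/-- The unit presheaf is a monoidal unit if both counits of an adjunction split. -/
def monoidalUnit {D : S → S} (A : ∀ L, SemigroupAdjunction L (D L))
    (s : ∀ X, X ⟶ (F ⊠ G) ⊠ X) (hs : ∀ X, s X ≫ adj.epsR X = 𝟙 X)
    (t : ∀ X, X ⟶ X ⊠ (F ⊠ G)) (ht : ∀ X, t X ≫ adj.epsL X = 𝟙 X) :
    MonoidalUnit (unitPresheaf k S) where
  leftUnitor := leftUnitIso adj A s hs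
  rightUnitor := rightUnitIso adj A t ht
  leftUnitor_naturality {P Q} φ := day_hom_ext fun f α p => by
    change ap (leftUnitHom Q) _ (ap (dayMap (𝟙 _) φ) _ (dayMk f α p)) =
      ap φ _ (ap (leftUnitHom P) _ (dayMk f α p))
    rw [dayMap_mk, leftUnitHom_mk, leftUnitHom_mk, ap_id, ap_res]
  rightUnitor_naturality {P Q} φ := day_hom_ext fun f p α => by
    change ap (rightUnitHom A Q) _ (ap (dayMap φ (𝟙 _)) _ (dayMk f p α)) =
      ap φ _ (ap (rightUnitHom A P) _ (dayMk f p α))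
    rw [dayMap_mk, rightUnitHom_mk, rightUnitHom_mk, ap_id, ap_res]
  triangle P Q := day_hom_ext₃ fun f g p α q => by
    change ap (dayMap (𝟙 P) (leftUnitHom Q)) _
        (ap (dayAssocHom P (unitPresheaf k S) Q) _ (dayMk f (dayMk g p α) q)) =
      ap (dayMap (rightUnitHom A P) (𝟙 Q)) _ (dayMk f (dayMk g p α) q)
    -- Both sides reduce to elements with the same `p` and `q`; their morphisms agree by
    -- `trLeft_whiskerRight`.
    rw [dayAssocHom_mk, dayMap_mk, dayMap_mk, leftUnitHom_mk, rightUnitHom_mk, ap_id, ap_id,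
      dayMk_res_right, dayMk_res_left, Category.id_comp, comp_whiskerRight,
      trLeft_whiskerRight]
    simp only [Category.assoc]

/-! ### The coequalizer -/

variable (k) in
/-- The morphism `Hom(-, F ⊠ G) ⟶ 𝟙` corresponding to the counit. -/
def counitHom : (yo k S).obj (F ⊠ G) ⟶ unitPresheaf k S :=
  homMk' (P := (yo k S).obj (F ⊠ G))
    (fun X =>
      { toFun := fun f : X ⟶ F ⊠ G => (unitPresheaf k S).res f (counitElt k adj)
        map_add' := fun f g => res_add _ f g _
        map_smul' := fun c f => res_smul _ c f _ })
    (fun {_ Y} f (g : Y ⟶ F ⊠ G) => res_comp (unitPresheaf k S) f g (counitElt k adj))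

theorem counitHom_apply {X : S} (f : X ⟶ F ⊠ G) :
    ap (counitHom k adj) X f = (unitPresheaf k S).res f (counitElt k adj) := rfl

/-- By the module axioms the two maps are `epsR (F ⊠ G)` and `epsL (F ⊠ G)`, which the counit
element does not distinguish. -/
theorem counitHom_condition :
    (yo k S).map ((aₛ (F ⊠ G) F G).inv ≫ adj.epsR F ▷ₛ G) ≫ counitHom k adj =
      (yo k S).map ((aₛ F G (F ⊠ G)).hom ≫ F ◁ₛ adj.epsL G) ≫ counitHom k adj := by
  rw [← adj.epsR_module, Iso.inv_hom_id_assoc, ← adj.epsL_module]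
  refine ext_ap fun X (f : X ⟶ (F ⊠ G) ⊠ (F ⊠ G)) => ?_
  change (unitPresheaf k S).res (f ≫ adj.epsR (F ⊠ G)) (counitElt k adj) =
    (unitPresheaf k S).res (f ≫ adj.epsL (F ⊠ G)) (counitElt k adj)
  rw [res_comp, res_comp, res_epsL_counitElt]

section Coequalizer

variable {D : S → S} (A : ∀ L, SemigroupAdjunction L (D L))
  (s : ∀ X, X ⟶ (F ⊠ G) ⊠ X)

/-- A section of the component of `counitHom` at `X`. -/
def counitSection (X : S) : (unitPresheaf k S).val X →ₗ[k] ((yo k S).obj (F ⊠ G)).val X where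
  toFun α := (s X ≫ trLeft A α (F ⊠ G) : X ⟶ F ⊠ G)
  map_add' α β :=
    (congrArg (s X ≫ ·) (trLeft_add A α β _)).trans (Preadditive.comp_add _ _ _ _ _ _)
  map_smul' c α :=
    (congrArg (s X ≫ ·) (trLeft_smul A c α _)).trans (Linear.comp_smul _ _ _ _ _ _)

theorem counitHom_counitSection (hs : ∀ X, s X ≫ adj.epsR X = 𝟙 X) {X : S}
    (α : (unitPresheaf k S).val X) :
    ap (counitHom k adj) X (counitSection A s X α) = α := by
  refine (counitHom_apply adj (s X ≫ trLeft A α (F ⊠ G))).trans ?_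
  rw [res_comp, ← res_epsR, ← res_comp, hs, res_id]

/-- The round trip need not fix `f`, but `f` and its image are the composites of the single morphism
`s X ≫ (F ⊠ G) ◁ₛ f` with `epsR` and `epsL`, which `ψ` identifies. This gives, pointwise, the
contraction of a split coequalizer. -/
theorem ap_counitSection_counitHom (hs : ∀ X, s X ≫ adj.epsR X = 𝟙 X) {Q : LinPresheaf k S}
    (ψ : (yo k S).obj (F ⊠ G) ⟶ Q)
    (hψ : (yo k S).map ((aₛ (F ⊠ G) F G).inv ≫ adj.epsR F ▷ₛ G) ≫ ψ =
      (yo k S).map ((aₛ F G (F ⊠ G)).hom ≫ F ◁ₛ adj.epsL G) ≫ ψ)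
    {X : S} (f : ((yo k S).obj (F ⊠ G)).val X) :
    ap ψ X (counitSection A s X (ap (counitHom k adj) X f)) = ap ψ X f := by
  change X ⟶ F ⊠ G at f
  rw [← adj.epsR_module, Iso.inv_hom_id_assoc, ← adj.epsL_module] at hψ
  have h (g : X ⟶ (F ⊠ G) ⊠ (F ⊠ G)) : ap ψ X (g ≫ adj.epsR (F ⊠ G) : X ⟶ F ⊠ G) =
      ap ψ X (g ≫ adj.epsL (F ⊠ G) : X ⟶ F ⊠ G) :=
    congrArg (fun χ : (yo k S).obj ((F ⊠ G) ⊠ (F ⊠ G)) ⟶ Q => ap χ X g) hψ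
  have e : (s X ≫ trLeft A ((unitPresheaf k S).res f (counitElt k adj)) (F ⊠ G)) =
      (s X ≫ (F ⊠ G) ◁ₛ f) ≫ adj.epsL (F ⊠ G) := by
    rw [trLeft_res, trLeft_counitElt, Category.assoc]
  have e' : (s X ≫ (F ⊠ G) ◁ₛ f) ≫ adj.epsR (F ⊠ G) = f := by
    rw [Category.assoc, adj.epsR_naturality, ← Category.assoc, hs, Category.id_comp]
  exact (congrArg (ap ψ X) e).trans ((h _).symm.trans (congrArg (ap ψ X) e'))

/-- The morphism out of the unit presheaf induced by a morphism coequalizing the pair. -/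
def counitDesc (hs : ∀ X, s X ≫ adj.epsR X = 𝟙 X) {Q : LinPresheaf k S}
    (ψ : (yo k S).obj (F ⊠ G) ⟶ Q)
    (hψ : (yo k S).map ((aₛ (F ⊠ G) F G).inv ≫ adj.epsR F ▷ₛ G) ≫ ψ =
      (yo k S).map ((aₛ F G (F ⊠ G)).hom ≫ F ◁ₛ adj.epsL G) ≫ ψ) :
    unitPresheaf k S ⟶ Q :=
  homMk' (fun X => (ap ψ X).comp (counitSection A s X)) fun {X Y} f α => by
    have h (Z : S) (g : ((yo k S).obj (F ⊠ G)).val Z) :=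
      ap_counitSection_counitHom adj A s hs ψ hψ g
    -- Although `counitSection` need not be natural, its composite with `ψ` is: writing `α` as an
    -- image under `counitHom` reduces the claim to naturality of `ψ`.
    rw [← counitHom_counitSection adj A s hs α, ← ap_res, LinearMap.comp_apply,
      LinearMap.comp_apply, h, h, ap_res]

/-- The unit presheaf is a coequalizer of the two multiplications of `F ⊠ G`. -/
def counitIsColimit (hs : ∀ X, s X ≫ adj.epsR X = 𝟙 X) :
    Limits.IsColimit (Limits.Cofork.ofπ (counitHom k adj) (counitHom_condition adj)) :=
  Limits.Cofork.IsColimit.mk _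
    (fun c => counitDesc adj A s hs c.π c.condition)
    (fun c => ext_ap fun _ f => ap_counitSection_counitHom adj A s hs c.π c.condition f)
    -- Uniqueness holds because `counitHom` is pointwise surjective.
    (fun c m hm => ext_ap fun X α => by
      have h : ap m X (ap (counitHom k adj) X (counitSection A s X α)) =
          ap c.π X (counitSection A s X α) :=
        congrArg (fun χ : (yo k S).obj (F ⊠ G) ⟶ c.pt => ap χ X (counitSection A s X α)) hm
      rw [counitHom_counitSection adj A s hs] at h
      exact h)

end Coequalizer

end Unit

end LinPresheaf

end

theorem theorem3p8 {k : Type w} [Field k] {S : Type u} [SmallCategory S] [Preadditive S]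
    [Linear k S] [SemigroupCategory S] [LinearSemigroupCategory k S]
    (hS : SemigroupCategory.IsRigid S) (F G : S)
    (adj : SemigroupCategory.SemigroupAdjunction F G)
    (hF : IsLiberal (SemigroupCategory.tensorLeft F)) :
    Nonempty (SemigroupCategory.MonoidalUnit (LinPresheaf.unitPresheaf k S)) ∧
    ∃ (π : (LinPresheaf.yo k S).obj (F ⊠ G) ⟶ LinPresheaf.unitPresheaf k S)
      (h : (LinPresheaf.yo k S).map ((aₛ (F ⊠ G) F G).inv ≫ adj.epsR F ▷ₛ G) ≫ π =
        (LinPresheaf.yo k S).map ((aₛ F G (F ⊠ G)).hom ≫ F ◁ₛ adj.epsL G) ≫ π),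
      Nonempty (Limits.IsColimit (Limits.Cofork.ofπ π h)) := by
  choose D A using fun L => (hS L).1
  choose E B using fun Y => (hS Y).2
  choose s hs using adj.exists_section_epsR hF
  -- The section of `epsL` at `Y` comes from the section of `epsR` at the left dual `E Y`; this is
  -- the only use of left duals.
  choose t ht using fun Y => adj.exists_section_epsL (B Y).some ⟨s (E Y), hs (E Y)⟩
  exact ⟨⟨LinPresheaf.monoidalUnit adj (fun L => (A L).some) s hs t ht⟩,
    LinPresheaf.counitHom k adj, LinPresheaf.counitHom_condition adj,
    ⟨LinPresheaf.counitIsColimit adj (fun L => (A L).some) s hs⟩⟩
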